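/- Let $E$ be a finite-dimensional operator space, i.e. $\mathbb C^n$ with the matrix norms induced by an injective linear map $\varphi:\mathbb C^n\to B(H)$, where $H$ is a complex Hilbert space and matrices over $B(H)$ are normed by $M_{k,l}(B(H))=B(H^l,H^k)$. A map is completely contractive (completely isometric) if all its entrywise amplifications to $k\times l$ matrices are contractive (isometric). Let $UC(E)$ be the universal commutative operator algebra of $E$: the completion of $\mathbb C[z_1,\dots,z_n]$ in the matrix norms $\|p\|=\sup_S\|p(S)\|$, the supremum being over all commuting $n$-tuples $S=(S_1,\dots,S_n)$ of operators on Hilbert spaces $K$ for which $\sigma_S:E\to B(K)$, $\sigma_S(z)=\sum_j z_jS_j$, is completely contractive. $E$ is mapped into $UC(E)$ by $x\mapsto\sum_j x_jz_j$. Let $OA_u(E)$ be Pisier's universal unital operator algebra of $E$: the completion of the tensor algebra $T(E)$ in the matrix norms $\|P\|=\sup_\sigma\|\hat\sigma(P)\|$, the supremum being over all completely contractive linear maps $\sigma:E\to B(K)$, where $\hat\sigma$ is the unital homomorphism extending $\sigma$. Let $\iota:E\to OA_u(E)$ be the canonical map, and let $\mathcal C$ be the commutator ideal of $OA_u(E)$,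 i.e. the closed two-sided ideal generated by all $ab-ba$. The quotient $OA_u(E)/\mathcal C$ carries the quotient matrix norms $M_{k,l}(OA_u(E)/\mathcal C)=M_{k,l}(OA_u(E))/M_{k,l}(\mathcal C)$. Then: 1. There is a unital algebra isomorphism $UC(E)\cong OA_u(E)/\mathcal C$ which is completely isometric and takes $\sum_j x_jz_j$ to $\iota(x)+\mathcal C$ for every $x\in E$. 2. The map $x\mapsto\iota(x)+\mathcal C$ from $E$ to $OA_u(E)/\mathcal C$ is completely isometric. 3. For every completely contractive linear map $\sigma:E\to B(K)$ with commutative range there is a unique completely contractive unital homomorphism $\pi:OA_u(E)/\mathcal C\to B(K)$ with $\pi(\iota(x)+\mathcal C)=\sigma(x)$ for all $x\in E$. -/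

import Mathlib

open UniformSpace

universe u v w

noncomputable section

namespace OpAlg

/-! ### Matrix norms -/

/-- A type `A` whose rectangular matrices carry a (semi)norm. This is a pure notation class (like
`Norm`); only the concrete instances constructed below are ever used. -/
class MatNorm (A : Type v) where
  /-- the norm of a `k × l` matrix with entries in `A` -/
  mnorm : ∀ {k l : ℕ}, Matrix (Fin k) (Fin l) A → ℝ

/-- A map is completely contractive if all its entrywise amplifications are contractive. -/
def IsCompletelyContractive {A : Type v} {B : Type w} [MatNorm A] [MatNorm B] (f : A → B) : Prop :=
  ∀ (k l : ℕ) (M : Matrix (Fin k) (Fin l) A), MatNorm.mnorm (M.map f) ≤ MatNorm.mnorm M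

/-- A map is completely isometric if all its entrywise amplifications are isometric. -/
def IsCompletelyIsometric {A : Type v} {B : Type w} [MatNorm A] [MatNorm B] (f : A → B) : Prop :=
  ∀ (k l : ℕ) (M : Matrix (Fin k) (Fin l) A), MatNorm.mnorm (M.map f) = MatNorm.mnorm M

section BlockOperators

variable {K : Type v} [NormedAddCommGroup K] [InnerProductSpace ℂ K]

/-- The operator `K^l → K^k` between Hilbert space direct sums given by a `k × l` matrix of
operators on `K`. -/
def blockOp {k l : ℕ} (T : Matrix (Fin k) (Fin l) (K →L[ℂ] K)) :
    PiLp 2 (fun _ : Fin l => K) →L[ℂ] PiLp 2 (fun _ : Fin k => K) :=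
  ((PiLp.continuousLinearEquiv 2 ℂ (fun _ : Fin k => K)).symm :
      (Fin k → K) →L[ℂ] PiLp 2 (fun _ : Fin k => K)) ∘L
    ContinuousLinearMap.pi fun i => ∑ j, T i j ∘L PiLp.proj 2 (fun _ : Fin l => K) j

theorem blockOp_apply {k l : ℕ} (T : Matrix (Fin k) (Fin l) (K →L[ℂ] K))
    (x : PiLp 2 (fun _ : Fin l => K)) (i : Fin k) : blockOp T x i = ∑ j, T i j (x j) := by
  simp [blockOp]

/-- The matrix norms of `B(K)`: the operator norm on `M_{k,l}(B(K)) = B(K^l, K^k)`. -/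
instance instMatNormOperators : MatNorm (K →L[ℂ] K) where
  mnorm T := ‖blockOp T‖

theorem norm_le_mnorm_of (T : K →L[ℂ] K) :
    ‖T‖ ≤ MatNorm.mnorm (Matrix.of fun (_ _ : Fin 1) => T) := by
  refine T.opNorm_le_bound (norm_nonneg (blockOp (Matrix.of fun (_ _ : Fin 1) => T))) fun x => ?_
  have h := (blockOp (Matrix.of fun (_ _ : Fin 1) => T)).le_opNorm
    (WithLp.toLp 2 fun _ : Fin 1 => x)
  change ‖T x‖ ≤ ‖blockOp (Matrix.of fun (_ _ : Fin 1) => T)‖ * ‖x‖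
  simpa [PiLp.norm_eq_of_L2, blockOp_apply] using h

end BlockOperators

/-! ### The closed commutator ideal and quotients -/

/-- The commutator ideal of a topological ring: the closed two-sided ideal generated by all
commutators `a * b - b * a`. -/
def commutatorIdeal (A : Type v) [Ring A] [TopologicalSpace A] [IsTopologicalRing A] : Ideal A :=
  (TwoSidedIdeal.asIdeal (TwoSidedIdeal.span {x : A | ∃ a b : A, x = a * b - b * a})).closure

instance (A : Type v) [Ring A] [TopologicalSpace A] [IsTopologicalRing A] :
    (commutatorIdeal A).IsTwoSided where
  mul_mem_of_left b ha :=
    map_mem_closure (f := fun x : A => x * b) (continuous_mul_const b) ha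
      fun _ h => Ideal.mul_mem_right b _ h

/-- The quotient operator space structure `M_{k,l}(A / I) = M_{k,l}(A) / M_{k,l}(I)`: the norm of a
matrix over the quotient is the infimum of the norms of its lifts. -/
instance instMatNormQuotient {A : Type v} [Ring A] [MatNorm A] (I : Ideal A) :
    MatNorm (A ⧸ I) where
  mnorm M := sInf {r | ∃ N : Matrix (Fin _) (Fin _) A,
    N.map (fun a => (Submodule.Quotient.mk a : A ⧸ I)) = M ∧ r = MatNorm.mnorm N}

/-! ### Completion of an algebra in the norm given by a class of representations -/

/-- A class of unital representations of the complex algebra `P` on Hilbert spaces, such that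
every element of `P` is uniformly bounded over the class. -/
structure RepClass (P : Type v) [Ring P] [Algebra ℂ P] where
  /-- the representation `π` of `P` on `K` belongs to the class -/
  Mem : ∀ {K : Type u} [NormedAddCommGroup K] [InnerProductSpace ℂ K] [CompleteSpace K],
    (P →ₐ[ℂ] (K →L[ℂ] K)) → Prop
  bounded : ∀ p : P, ∃ C : ℝ, ∀ (K : Type u) [NormedAddCommGroup K] [InnerProductSpace ℂ K]
    [CompleteSpace K] (π : P →ₐ[ℂ] (K →L[ℂ] K)), Mem π → ‖π p‖ ≤ C

namespace RepClass

variable {P : Type v} [Ring P] [Algebra ℂ P] (F : RepClass.{u} P)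

/-- The algebra `P`, equipped with the seminorm `‖p‖ = sup ‖π(p)‖` over `π` in the class `F`. -/
def Alg (_ : RepClass.{u} P) : Type v := P

instance : Ring F.Alg := inferInstanceAs (Ring P)

instance : Algebra ℂ F.Alg := inferInstanceAs (Algebra ℂ P)

/-- The identity map `P → Alg`, as an algebra isomorphism. -/
def toAlg : P ≃ₐ[ℂ] F.Alg := AlgEquiv.refl

section

variable {K : Type u} [NormedAddCommGroup K] [InnerProductSpace ℂ K]

/-- A representation of `P`, viewed as a representation of `Alg`. -/
def rep (π : P →ₐ[ℂ] (K →L[ℂ] K)) : F.Alg →ₐ[ℂ] (K →L[ℂ] K) := π.comp F.toAlg.symm.toAlgHom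

theorem rep_toAlg (π : P →ₐ[ℂ] (K →L[ℂ] K)) (p : P) : F.rep π (F.toAlg p) = π p := rfl

end

instance : Norm F.Alg where
  norm p := sSup {r | ∃ (K : Type u) (_ : NormedAddCommGroup K) (_ : InnerProductSpace ℂ K)
    (_ : CompleteSpace K) (π : P →ₐ[ℂ] (K →L[ℂ] K)), F.Mem π ∧ r = ‖F.rep π p‖}

theorem norm_rep_le {K : Type u} [NormedAddCommGroup K] [InnerProductSpace ℂ K] [CompleteSpace K]
    {π : P →ₐ[ℂ] (K →L[ℂ] K)} (hπ : F.Mem π) (p : F.Alg) : ‖F.rep π p‖ ≤ ‖p‖ := by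
  refine le_csSup ?_ ⟨K, _, _, _, π, hπ, rfl⟩
  obtain ⟨C, hC⟩ := F.bounded (F.toAlg.symm p)
  refine ⟨C, ?_⟩
  rintro r ⟨K, _, _, _, π, hπ, rfl⟩
  exact hC K π hπ

theorem norm_alg_nonneg (p : F.Alg) : 0 ≤ ‖p‖ := by
  refine Real.sSup_nonneg ?_
  rintro r ⟨K, _, _, _, π, hπ, rfl⟩
  exact norm_nonneg _

theorem norm_alg_le (p : F.Alg) {C : ℝ} (hC : 0 ≤ C)
    (h : ∀ (K : Type u) [NormedAddCommGroup K] [InnerProductSpace ℂ K] [CompleteSpace K]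
      (π : P →ₐ[ℂ] (K →L[ℂ] K)), F.Mem π → ‖F.rep π p‖ ≤ C) : ‖p‖ ≤ C := by
  refine Real.sSup_le ?_ hC
  rintro r ⟨K, _, _, _, π, hπ, rfl⟩
  exact h K π hπ

/-- The seminorm `p ↦ sup ‖π(p)‖`. -/
def groupSeminorm : AddGroupSeminorm F.Alg where
  toFun p := ‖p‖
  map_zero' := le_antisymm
    (F.norm_alg_le _ le_rfl fun K _ _ _ π _ => by rw [map_zero, norm_zero])
    (F.norm_alg_nonneg _)
  add_le' p q := by
    refine F.norm_alg_le _ (add_nonneg (F.norm_alg_nonneg p) (F.norm_alg_nonneg q)) ?_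
    intro K _ _ _ π hπ
    rw [map_add]
    exact (norm_add_le _ _).trans (add_le_add (F.norm_rep_le hπ p) (F.norm_rep_le hπ q))
  neg' p := by
    refine le_antisymm ?_ ?_
    · refine F.norm_alg_le _ (F.norm_alg_nonneg p) fun K _ _ _ π hπ => ?_
      rw [map_neg, norm_neg]
      exact F.norm_rep_le hπ p
    · refine F.norm_alg_le _ (F.norm_alg_nonneg (-p)) fun K _ _ _ π hπ => ?_
      rw [← norm_neg, ← map_neg]
      exact F.norm_rep_le hπ (-p)

instance : SeminormedRing F.Alg where
  __ := F.groupSeminorm.toSeminormedAddCommGroup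
  __ := (inferInstance : Ring F.Alg)
  norm_mul_le p q := by
    refine F.norm_alg_le _ (mul_nonneg (F.norm_alg_nonneg p) (F.norm_alg_nonneg q)) ?_
    intro K _ _ _ π hπ
    rw [map_mul]
    exact (norm_mul_le _ _).trans (mul_le_mul (F.norm_rep_le hπ p) (F.norm_rep_le hπ q)
      (norm_nonneg _) (F.norm_alg_nonneg p))

instance : NormedAlgebra ℂ F.Alg where
  norm_smul_le c p := by
    refine F.norm_alg_le _ (mul_nonneg (norm_nonneg c) (F.norm_alg_nonneg p)) ?_
    intro K _ _ _ π hπ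
    rw [map_smul, norm_smul]
    exact mul_le_mul_of_nonneg_left (F.norm_rep_le hπ p) (norm_nonneg c)

/-- The (separated) completion of `P` in the norm `‖p‖ = sup ‖π(p)‖`. -/
abbrev Compl : Type v := Completion F.Alg

/-- The canonical map from `P` to its completion. -/
def toCompl (p : P) : F.Compl := (F.toAlg p : Completion F.Alg)

/-- The continuous extension to the completion of a representation of `P` in the class `F`. -/
def extend {K : Type u} [NormedAddCommGroup K] [InnerProductSpace ℂ K] [CompleteSpace K]
    (π : P →ₐ[ℂ] (K →L[ℂ] K)) : F.Compl → (K →L[ℂ] K) :=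
  Completion.extension (F.rep π)

theorem uniformContinuous_rep {K : Type u} [NormedAddCommGroup K] [InnerProductSpace ℂ K]
    [CompleteSpace K] {π : P →ₐ[ℂ] (K →L[ℂ] K)} (hπ : F.Mem π) :
    UniformContinuous (F.rep π) := by
  refine (LipschitzWith.of_dist_le_mul (K := 1) fun p q => ?_).uniformContinuous
  rw [dist_eq_norm, dist_eq_norm, NNReal.coe_one, one_mul, ← map_sub]
  exact F.norm_rep_le hπ _

/-- For `π` in the class, `extend π` really extends `π`. -/
theorem extend_toCompl {K : Type u} [NormedAddCommGroup K] [InnerProductSpace ℂ K]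
    [CompleteSpace K] {π : P →ₐ[ℂ] (K →L[ℂ] K)} (hπ : F.Mem π) (p : P) :
    F.extend π (F.toCompl p) = π p :=
  Completion.extension_coe (F.uniformContinuous_rep hπ) _

/-- The operator algebra structure of the completion: the norm of a matrix `M` is the supremum of
the norms of the operator matrices `π(M)`, over all `π` in the class. -/
instance instMatNormCompl : MatNorm F.Compl where
  mnorm M := sSup {r | ∃ (K : Type u) (_ : NormedAddCommGroup K) (_ : InnerProductSpace ℂ K)
    (_ : CompleteSpace K) (π : P →ₐ[ℂ] (K →L[ℂ] K)), F.Mem π ∧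
      r = MatNorm.mnorm (M.map (F.extend π))}

end RepClass

/-! ### Finite-dimensional operator spaces -/

/-- An operator space structure on `ℂⁿ`: an injective linear map `φ : ℂⁿ → B(H)` into the bounded
operators on a Hilbert space, through which `ℂⁿ` inherits its norm and its matrix norms. -/
structure OperatorSpace (n : ℕ) where
  /-- the Hilbert space -/
  H : Type u
  [normedAddCommGroup : NormedAddCommGroup H]
  [innerProductSpace : InnerProductSpace ℂ H]
  [completeSpace : CompleteSpace H]
  /-- the embedding -/
  φ : (Fin n → ℂ) →ₗ[ℂ] (H →L[ℂ] H)
  injective : Function.Injective φ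

namespace OperatorSpace

attribute [instance] normedAddCommGroup innerProductSpace completeSpace

variable {n : ℕ} (E : OperatorSpace.{u} n)

/-- The underlying vector space `ℂⁿ` of `E`. -/
def Space (_ : OperatorSpace.{u} n) : Type := Fin n → ℂ

instance : AddCommGroup E.Space := inferInstanceAs (AddCommGroup (Fin n → ℂ))

instance : Module ℂ E.Space := inferInstanceAs (Module ℂ (Fin n → ℂ))

/-- The matrix norms of `E`, inherited from `B(H)`. -/
instance : MatNorm E.Space where
  mnorm M := MatNorm.mnorm (M.map fun x => E.φ x)

/-! ### The universal unital operator algebra `OA_u(E)` -/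

/-- The representations of the tensor algebra `T(E)` that extend completely contractive linear
maps `σ : E → B(K)`. -/
def tensorReps : RepClass.{u} (TensorAlgebra ℂ E.Space) where
  Mem {K} _ _ _ π := ∃ σ : E.Space →ₗ[ℂ] (K →L[ℂ] K),
    IsCompletelyContractive σ ∧ π = TensorAlgebra.lift ℂ σ
  bounded p := by
    induction p using TensorAlgebra.induction with
    | algebraMap r =>
      refine ⟨‖r‖, ?_⟩
      rintro K _ _ _ π -
      rw [AlgHom.commutes, Algebra.algebraMap_eq_smul_one, norm_smul]
      exact mul_le_of_le_one_right (norm_nonneg r) ContinuousLinearMap.norm_id_le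
    | ι x =>
      refine ⟨MatNorm.mnorm (Matrix.of fun (_ _ : Fin 1) => x), ?_⟩
      rintro K _ _ _ π ⟨σ, hσ, rfl⟩
      rw [TensorAlgebra.lift_ι_apply]
      exact (norm_le_mnorm_of (σ x)).trans (hσ 1 1 (Matrix.of fun (_ _ : Fin 1) => x))
    | mul a b ha hb =>
      obtain ⟨C, hC⟩ := ha
      obtain ⟨D, hD⟩ := hb
      refine ⟨|C| * |D|, ?_⟩
      intro K _ _ _ π hπ
      rw [map_mul]
      exact (norm_mul_le _ _).trans (mul_le_mul ((hC K π hπ).trans (le_abs_self C))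
        ((hD K π hπ).trans (le_abs_self D)) (norm_nonneg _) (abs_nonneg C))
    | add a b ha hb =>
      obtain ⟨C, hC⟩ := ha
      obtain ⟨D, hD⟩ := hb
      refine ⟨C + D, ?_⟩
      intro K _ _ _ π hπ
      rw [map_add]
      exact (norm_add_le _ _).trans (add_le_add (hC K π hπ) (hD K π hπ))

/-- The universal unital operator algebra `OA_u(E)`: the completion of the tensor algebra `T(E)` in
the norms `‖P‖ = sup ‖σ̂(P)‖`, over all completely contractive `σ : E → B(K)`, where `σ̂` is the
unital homomorphism on `T(E)` extending `σ`. -/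
abbrev OAu : Type := E.tensorReps.Compl

/-- The canonical map `E → OA_u(E)`. -/
def ιOA (x : E.Space) : E.OAu := E.tensorReps.toCompl (TensorAlgebra.ι ℂ x)

/-! ### The universal commutative operator algebra `UC(E)` -/

/-- The map `σ_S(z) = ∑ z_j S_j` determined by an `n`-tuple `S` of operators. -/
def tupleMap {K : Type u} [NormedAddCommGroup K] [InnerProductSpace ℂ K]
    (S : Fin n → (K →L[ℂ] K)) : E.Space →ₗ[ℂ] (K →L[ℂ] K) :=
  Fintype.linearCombination ℂ S

/-- Evaluation `p ↦ p(S)` of polynomials at a commuting `n`-tuple `S` of operators. -/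
def polyEval {K : Type u} [NormedAddCommGroup K] [InnerProductSpace ℂ K]
    (S : Fin n → (K →L[ℂ] K)) (hS : ∀ i j, S i * S j = S j * S i) :
    MvPolynomial (Fin n) ℂ →ₐ[ℂ] (K →L[ℂ] K) :=
  letI : CommRing (Algebra.adjoin ℂ (Set.range S)) :=
    { (inferInstance : Ring (Algebra.adjoin ℂ (Set.range S))) with
      mul_comm := (Algebra.isMulCommutative_adjoin ℂ (by
        rintro _ ⟨i, rfl⟩ _ ⟨j, rfl⟩
        exact hS i j)).is_comm.comm }
  (Algebra.adjoin ℂ (Set.range S)).val.comp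
    (MvPolynomial.aeval fun j => ⟨S j, Algebra.subset_adjoin ⟨j, rfl⟩⟩)

theorem polyEval_X {K : Type u} [NormedAddCommGroup K] [InnerProductSpace ℂ K]
    (S : Fin n → (K →L[ℂ] K)) (hS : ∀ i j, S i * S j = S j * S i) (j : Fin n) :
    polyEval S hS (MvPolynomial.X j) = S j := by
  simp [polyEval]

/-- The representations `p ↦ p(S)` of the polynomial algebra, where `S` is a commuting `n`-tuple of
operators on a Hilbert space `K` such that `σ_S : E → B(K)` is completely contractive. -/
def polyReps : RepClass.{u} (MvPolynomial (Fin n) ℂ) where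
  Mem {K} _ _ _ π := ∃ (S : Fin n → (K →L[ℂ] K)) (hS : ∀ i j, S i * S j = S j * S i),
    IsCompletelyContractive (E.tupleMap S) ∧ π = polyEval S hS
  bounded p := by
    induction p using MvPolynomial.induction_on with
    | C r =>
      refine ⟨‖r‖, ?_⟩
      rintro K _ _ _ π -
      rw [← MvPolynomial.algebraMap_eq, AlgHom.commutes, Algebra.algebraMap_eq_smul_one, norm_smul]
      exact mul_le_of_le_one_right (norm_nonneg r) ContinuousLinearMap.norm_id_le
    | add a b ha hb =>
      obtain ⟨C, hC⟩ := ha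
      obtain ⟨D, hD⟩ := hb
      refine ⟨C + D, ?_⟩
      intro K _ _ _ π hπ
      rw [map_add]
      exact (norm_add_le _ _).trans (add_le_add (hC K π hπ) (hD K π hπ))
    | mul_X a j ha =>
      obtain ⟨C, hC⟩ := ha
      let x : E.Space := (Pi.single j 1 : Fin n → ℂ)
      refine ⟨|C| * |MatNorm.mnorm (Matrix.of fun (_ _ : Fin 1) => x)|, ?_⟩
      intro K _ _ _ π hπ
      rw [map_mul]
      refine (norm_mul_le _ _).trans (mul_le_mul ((hC K π hπ).trans (le_abs_self C))
        (le_trans ?_ (le_abs_self _)) (norm_nonneg _) (abs_nonneg C))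
      obtain ⟨S, hS, hcc, rfl⟩ := hπ
      have hx : E.tupleMap S x = S j := by
        change Fintype.linearCombination ℂ S (Pi.single j 1) = S j
        simp
      rw [polyEval_X, ← hx]
      exact (norm_le_mnorm_of _).trans (hcc 1 1 (Matrix.of fun (_ _ : Fin 1) => x))

/-- The universal commutative operator algebra `UC(E)`: the completion of `ℂ[z_1, …, z_n]` in the
norms `‖p‖ = sup ‖p(S)‖`, over all commuting `n`-tuples `S` of operators such that `σ_S` is
completely contractive on `E`. -/
abbrev UC : Type := E.polyReps.Compl

/-- The canonical map `E → UC(E)`, taking `(x_1, …, x_n)` to the polynomial `∑ x_j z_j`. -/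
def ιUC (x : E.Space) : E.UC := E.polyReps.toCompl (∑ j, MvPolynomial.C (x j) * MvPolynomial.X j)

end OperatorSpace

end OpAlg

end

namespace OpAlg

/-! ### Estimates for block operators -/

section BlockOperators

variable {K : Type v} [NormedAddCommGroup K] [InnerProductSpace ℂ K]
  {H : Type w} [NormedAddCommGroup H] [InnerProductSpace ℂ H]

/-! A completely contractive map with commutative range extends to T(E) through ℂ[z]. Hence `toPoly`
induces a homomorphism h : OA_u(E)/𝒞 → UC(E), completely contractive because the representations
defining UC(E) are, after composition with `toPoly`, among those defining OA_u(E). The substance is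
the reverse inequality `mnorm_mk_toCompl_le`. It rests on `exists_commuting_mnorm_ge`: if all
translates of a matrix V by matrices over ker `toPoly` have norm above c, then V has norm at least c
in some commuting completely contractive representation.

To see this, encode a representation σ with vectors x_1, …, x_l as the form B(v, w) = ⟨∑ σ̂(v_j)x_j,
∑ σ̂(w_j)x_j⟩ on rows over T(E). By a GNS argument such forms are the contractive ones. Those with
∑‖x_j‖² ≤ 1 make up a compact convex set, on which the supremum of ∑ B(V_i, V_i) is ‖V‖². The sum ∑
B(V_i + N_i, V_i + N_i) is linear in B and convex in N, so a minimax argument gives a single B for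
which it is at least c² for every N over the kernel.

In the GNS space of B, compress to the orthogonal complement of the image of the rows over the
kernel. These rows are invariant and contain all commutators, so the compressed operators commute.
The projection of the vector of V_i has norm equal to the distance from that vector to the subspace,
so V keeps norm at least c.

Density extends the isometry to the whole quotient (`isCompletelyIsometric_hom`), and completeness
makes h onto (`bijective_hom`). Operators in the upper right corner of 2 × 2 block matrices commute,
which embeds E completely isometrically. The universal property of UC(E) then transports along h. -/

theorem mnorm_operator_eq {k l : ℕ} (T : Matrix (Fin k) (Fin l) (K →L[ℂ] K)) :
    MatNorm.mnorm T = ‖blockOp T‖ := rfl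

theorem sum_norm_sq_blockOp_le {k l : ℕ} (T : Matrix (Fin k) (Fin l) (K →L[ℂ] K))
    (x : Fin l → K) :
    ∑ i, ‖∑ j, T i j (x j)‖ ^ 2 ≤ MatNorm.mnorm T ^ 2 * ∑ j, ‖x j‖ ^ 2 := by
  have h := (blockOp T).le_opNorm (WithLp.toLp 2 x)
  have h2 := pow_le_pow_left₀ (norm_nonneg _) h 2
  rw [mul_pow, PiLp.norm_sq_eq_of_L2, PiLp.norm_sq_eq_of_L2] at h2
  simpa [blockOp_apply, mnorm_operator_eq] using h2

theorem mnorm_operator_le {k l : ℕ} (T : Matrix (Fin k) (Fin l) (K →L[ℂ] K)) {C : ℝ}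
    (hC : 0 ≤ C)
    (h : ∀ x : Fin l → K, ∑ i, ‖∑ j, T i j (x j)‖ ^ 2 ≤ C ^ 2 * ∑ j, ‖x j‖ ^ 2) :
    MatNorm.mnorm T ≤ C := by
  refine (blockOp T).opNorm_le_bound hC fun x => ?_
  refine le_of_sq_le_sq ?_ (by positivity)
  rw [mul_pow, PiLp.norm_sq_eq_of_L2, PiLp.norm_sq_eq_of_L2]
  simpa [blockOp_apply] using h x

theorem mnorm_operator_nonneg {k l : ℕ} (T : Matrix (Fin k) (Fin l) (K →L[ℂ] K)) :
    0 ≤ MatNorm.mnorm T := norm_nonneg (blockOp T)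

theorem mnorm_operator_add_le {k l : ℕ} (S T : Matrix (Fin k) (Fin l) (K →L[ℂ] K)) :
    MatNorm.mnorm (S + T) ≤ MatNorm.mnorm S + MatNorm.mnorm T := by
  have : blockOp (S + T) = blockOp S + blockOp T := by
    ext x i
    simp [blockOp_apply, Finset.sum_add_distrib]
  rw [mnorm_operator_eq, this]
  exact norm_add_le (blockOp S) (blockOp T)

theorem mnorm_operator_le_sum_norm {k l : ℕ} (T : Matrix (Fin k) (Fin l) (K →L[ℂ] K)) :
    MatNorm.mnorm T ≤ ∑ i, ∑ j, ‖T i j‖ := by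
  refine (blockOp T).opNorm_le_bound (by positivity) fun x => ?_
  calc ‖blockOp T x‖ ≤ ∑ i, ‖blockOp T x i‖ := by
        refine le_of_sq_le_sq ?_ (Finset.sum_nonneg fun i _ => norm_nonneg (blockOp T x i))
        rw [PiLp.norm_sq_eq_of_L2]
        exact Finset.sum_sq_le_sq_sum_of_nonneg fun i _ => norm_nonneg _
    _ ≤ ∑ i, ∑ j, ‖T i j‖ * ‖x‖ := by
        refine Finset.sum_le_sum fun i _ => ?_
        rw [blockOp_apply]
        refine (norm_sum_le _ _).trans (Finset.sum_le_sum fun j _ => ?_)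
        exact ((T i j).le_opNorm _).trans
          (mul_le_mul_of_nonneg_left (PiLp.norm_apply_le x j) (norm_nonneg _))
    _ = (∑ i, ∑ j, ‖T i j‖) * ‖x‖ := by simp only [Finset.sum_mul]

/-- Multiplication by contractions on both sides is completely contractive. -/
theorem mnorm_operator_le_of_contraction {k l : ℕ} (S : Matrix (Fin k) (Fin l) (K →L[ℂ] K))
    (T : Matrix (Fin k) (Fin l) (H →L[ℂ] H)) (a : K →ₗ[ℂ] H) (b : H →ₗ[ℂ] K)
    (ha : ∀ x, ‖a x‖ ≤ ‖x‖) (hb : ∀ x, ‖b x‖ ≤ ‖x‖)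
    (h : ∀ i j x, T i j x = a (S i j (b x))) :
    MatNorm.mnorm T ≤ MatNorm.mnorm S := by
  refine mnorm_operator_le T (mnorm_operator_nonneg S) fun x => ?_
  simp only [h, ← map_sum]
  calc ∑ i, ‖a (∑ j, S i j (b (x j)))‖ ^ 2 ≤ ∑ i, ‖∑ j, S i j (b (x j))‖ ^ 2 := by
        gcongr; exact ha _
    _ ≤ MatNorm.mnorm S ^ 2 * ∑ j, ‖b (x j)‖ ^ 2 := sum_norm_sq_blockOp_le S _
    _ ≤ MatNorm.mnorm S ^ 2 * ∑ j, ‖x j‖ ^ 2 := by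
        gcongr; exact hb _

end BlockOperators

/-! ### A minimax principle -/

/-- If a family of continuous linear functionals is closed under convex combinations up to `≤`,
then it has a member that is `< c` on a compact convex set as soon as every point of the set has
a member `< c`. -/
theorem exists_forall_lt_of_forall_exists_lt {X N : Type*} [AddCommGroup X] [Module ℝ X]
    [TopologicalSpace X] [Nonempty N] (g : N → X →L[ℝ] ℝ) {s : Set X} (hs : IsCompact s)
    (hc : Convex ℝ s)
    (hg : ∀ (t : Finset N) (a : N → ℝ), (∀ i ∈ t, 0 ≤ a i) → ∑ i ∈ t, a i = 1 →
      ∃ i, ∀ x ∈ s, g i x ≤ ∑ j ∈ t, a j * g j x)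
    {c : ℝ} (h : ∀ x ∈ s, ∃ i, g i x < c) : ∃ i, ∀ x ∈ s, g i x < c := by
  classical
  rcases s.eq_empty_or_nonempty with rfl | ⟨x₀, hx₀⟩
  · exact ⟨Classical.arbitrary N, by simp⟩
  obtain ⟨t, ht⟩ := hs.elim_finite_subcover (fun i => {x | g i x < c})
    (fun i => isOpen_lt (g i).continuous continuous_const)
    (fun x hx => Set.mem_iUnion.2 (h x hx))
  -- By compactness finitely many functionals suffice. The compact convex image of `s` in ℝ^t misses
  -- the closed convex orthant where all coordinates are at least `c`, so a functional separates the
  -- two.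
  let G : X →L[ℝ] (t → ℝ) := ContinuousLinearMap.pi fun i => g i
  have hD : Convex ℝ {y : t → ℝ | ∀ i, c ≤ y i} := by
    have : {y : t → ℝ | ∀ i, c ≤ y i} = Set.Ici fun _ => c := by ext; rfl
    rw [this]
    exact convex_Ici _
  have hDc : IsClosed {y : t → ℝ | ∀ i, c ≤ y i} := by
    have : {y : t → ℝ | ∀ i, c ≤ y i} = Set.Ici fun _ => c := by ext; rfl
    rw [this]
    exact isClosed_Ici
  have hdisj : Disjoint (G '' s) {y : t → ℝ | ∀ i, c ≤ y i} := by
    rw [Set.disjoint_left]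
    rintro _ ⟨x, hx, rfl⟩ hy
    obtain ⟨i, hi, hlt⟩ := Set.mem_iUnion₂.1 (ht hx)
    exact absurd (hy ⟨i, hi⟩) (not_le.2 hlt)
  obtain ⟨f, α, β, hα, hαβ, hβ⟩ := geometric_hahn_banach_compact_closed
    (hc.linear_image G.toLinearMap) (hs.image G.continuous) hD hDc hdisj
  let b : t → ℝ := fun i => f (Pi.single i 1)
  have hf : ∀ y, f y = ∑ i, y i * b i := fun y => by
    conv_lhs => rw [pi_eq_sum_univ' y]
    simp only [map_sum, map_smul, smul_eq_mul, b]
  have hb : ∀ i, 0 ≤ b i := by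
    intro i
    by_contra! hi
    -- If `b i < 0`, moving from the corner of the orthant along the `i`-th axis decreases `f`. The
    -- step length is chosen so that `f` becomes exactly `β`, against the strict bound on the
    -- orthant.
    have hmem : (fun _ => c) + (((f fun _ => c) - β) / (-b i)) • Pi.single i (1 : ℝ) ∈
        {y : t → ℝ | ∀ i, c ≤ y i} := by
      have h0 : 0 ≤ ((f fun _ => c) - β) / (-b i) :=
        div_nonneg (sub_nonneg.2 (hβ _ fun _ => le_rfl).le) (by linarith)
      intro j
      by_cases hj : j = i
      · subst hj; simpa using h0
      · simp [hj]
    have h1 := hβ _ hmem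
    rw [map_add, map_smul, smul_eq_mul, show f (Pi.single i 1) = b i from rfl, div_neg, neg_mul,
      div_mul_cancel₀ _ hi.ne] at h1
    linarith
  have hlt := ((hα _ ⟨x₀, hx₀, rfl⟩).trans hαβ).trans (hβ (fun _ => c) fun _ => le_rfl)
  have hsum : 0 < ∑ i, b i := by
    refine lt_of_le_of_ne (Finset.sum_nonneg fun i _ => hb i) fun h0 => ?_
    have hz : ∀ i, b i = 0 := fun i =>
      (Finset.sum_eq_zero_iff_of_nonneg fun i _ => hb i).1 h0.symm i (Finset.mem_univ i)
    simp [hf, hz] at hlt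
  -- The normalized separating functional supplies the convex weights, set to zero off `t`.
  obtain ⟨i, hi⟩ := hg t (fun j => if hj : j ∈ t then b ⟨j, hj⟩ / ∑ i, b i else 0)
    (fun j hj => by simpa [hj] using div_nonneg (hb _) hsum.le)
    (by
      rw [← Finset.sum_coe_sort]
      simp only [Finset.coe_mem, Subtype.coe_eta, dite_true]
      rw [← Finset.sum_div, div_self hsum.ne'])
  refine ⟨i, fun x hx => (hi x hx).trans_lt ?_⟩
  have h1 := hf (G x) ▸ (hα _ ⟨x, hx, rfl⟩).trans
    (hαβ.trans (hβ (fun _ => c) fun _ => le_rfl))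
  rw [hf, ← Finset.mul_sum, ← div_lt_iff₀ hsum] at h1
  refine lt_of_eq_of_lt ?_ h1
  rw [← Finset.sum_coe_sort, Finset.sum_div]
  refine Finset.sum_congr rfl fun j _ => ?_
  simp only [Finset.coe_mem, Subtype.coe_eta, dite_true, G, ContinuousLinearMap.coe_pi']
  ring

/-! ### The GNS construction -/

/-- A semidefinite form gives a seminorm; the separated completion kills its null vectors, so no
positive definiteness is required. -/
theorem exists_completion_of_form {W : Type u} [AddCommGroup W] [Module ℂ W]
    (c : PreInnerProductSpace.Core ℂ W) :
    ∃ (K : Type u) (_ : NormedAddCommGroup K) (_ : InnerProductSpace ℂ K) (_ : CompleteSpace K)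
      (f : W →ₗ[ℂ] K), DenseRange f ∧ ∀ v w, inner ℂ (f v) (f w) = c.inner v w := by
  let : SeminormedAddCommGroup W := @InnerProductSpace.Core.toSeminormedAddCommGroup ℂ W _ _ _ c
  let : InnerProductSpace ℂ W := InnerProductSpace.ofCore c
  exact ⟨Completion W, inferInstance, inferInstance, inferInstance,
    (Completion.toComplL : W →L[ℂ] Completion W).toLinearMap, Completion.denseRange_coe,
    fun v w => Completion.inner_coe v w⟩

/-! ### Contractive forms and their representations -/

section Forms

open TensorAlgebra (ι)

variable {n : ℕ} {E : OperatorSpace.{u} n} {W : Type u} [AddCommGroup W] [Module ℂ W]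
  [Module (TensorAlgebra ℂ E.Space) W]

variable (E) in
/-- A positive semidefinite sesquilinear form on a module over `T(E)`, for which the action of `E`
is completely contractive. -/
structure IsContractiveForm (B : W → W → ℂ) : Prop where
  conj_symm : ∀ v w, (starRingEnd ℂ) (B w v) = B v w
  re_nonneg : ∀ v, 0 ≤ (B v v).re
  add_left : ∀ v v' w, B (v + v') w = B v w + B v' w
  smul_left : ∀ (v w) (r : ℂ), B (r • v) w = (starRingEnd ℂ) r * B v w
  contr : ∀ (k m : ℕ) (x : Matrix (Fin k) (Fin m) E.Space) (v : Fin m → W),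
    ∑ p, (B (∑ q, ι ℂ (x p q) • v q) (∑ q, ι ℂ (x p q) • v q)).re ≤
      MatNorm.mnorm x ^ 2 * ∑ q, (B (v q) (v q)).re

/-- `f : W → K` intertwines the action of `T(E)` on `W` with the linear map `σ : E → B(K)`. -/
def Intertwines {K : Type u} [NormedAddCommGroup K] [InnerProductSpace ℂ K]
    (σ : E.Space →ₗ[ℂ] (K →L[ℂ] K)) (f : W →ₗ[ℂ] K) : Prop :=
  ∀ x v, σ x (f v) = f (ι ℂ x • v)

theorem Intertwines.lift_apply [IsScalarTower ℂ (TensorAlgebra ℂ E.Space) W] {K : Type u} [NormedAddCommGroup K] [InnerProductSpace ℂ K]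
    {σ : E.Space →ₗ[ℂ] (K →L[ℂ] K)} {f : W →ₗ[ℂ] K} (h : Intertwines σ f)
    (p : TensorAlgebra ℂ E.Space) (v : W) : TensorAlgebra.lift ℂ σ p (f v) = f (p • v) := by
  induction p using TensorAlgebra.induction generalizing v with
  | algebraMap r => simp [Algebra.algebraMap_eq_smul_one]
  | ι x => simpa using h x v
  | mul a b ha hb => rw [map_mul, mul_apply_eq_comp, hb, ha, mul_smul]
  | add a b ha hb => rw [map_add, add_apply, ha, hb, add_smul, map_add]

theorem mnorm_space_nonneg {k l : ℕ} (x : Matrix (Fin k) (Fin l) E.Space) :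
    0 ≤ MatNorm.mnorm x := mnorm_operator_nonneg (x.map fun y => E.φ y)

/-- A completely contractive map, together with an intertwiner, induces a contractive form. -/
theorem isContractiveForm_of_intertwines {K : Type u} [NormedAddCommGroup K]
    [InnerProductSpace ℂ K] {σ : E.Space →ₗ[ℂ] (K →L[ℂ] K)} (hσ : IsCompletelyContractive σ)
    {f : W →ₗ[ℂ] K} (h : Intertwines σ f) :
    IsContractiveForm E fun v w => inner ℂ (f v) (f w) where
  conj_symm v w := inner_conj_symm _ _
  re_nonneg v := inner_self_nonneg (𝕜 := ℂ)
  add_left v v' w := by rw [map_add, inner_add_left]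
  smul_left v w r := by rw [map_smul, inner_smul_left]
  contr k m x v := by
    have key : ∀ y : K, (inner ℂ y y).re = ‖y‖ ^ 2 := fun y => inner_self_eq_norm_sq (𝕜 := ℂ) y
    simp only [key, map_sum, ← h _ _]
    refine (sum_norm_sq_blockOp_le (x.map σ) fun q => f (v q)).trans ?_
    gcongr
    · exact mnorm_operator_nonneg _
    · exact hσ k m x

/-- The GNS construction for contractive forms. -/
theorem IsContractiveForm.exists_rep [IsScalarTower ℂ (TensorAlgebra ℂ E.Space) W]
    {B : W → W → ℂ} (hB : IsContractiveForm E B) :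
    ∃ (K : Type u) (_ : NormedAddCommGroup K) (_ : InnerProductSpace ℂ K) (_ : CompleteSpace K)
      (σ : E.Space →ₗ[ℂ] (K →L[ℂ] K)) (f : W →ₗ[ℂ] K), IsCompletelyContractive σ ∧
      DenseRange f ∧ Intertwines σ f ∧ ∀ v w, inner ℂ (f v) (f w) = B v w := by
  obtain ⟨K, _, _, _, f, hf, hfB⟩ := exists_completion_of_form
    { inner := B
      conj_inner_symm := hB.conj_symm
      re_inner_nonneg := hB.re_nonneg
      add_left := hB.add_left
      smul_left := hB.smul_left : PreInnerProductSpace.Core ℂ W }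
  replace hfB : ∀ v w, inner ℂ (f v) (f w) = B v w := hfB
  have hre : ∀ v, (B v v).re = ‖f v‖ ^ 2 := fun v => by
    rw [← hfB]; exact inner_self_eq_norm_sq (𝕜 := ℂ) _
  have hbd : ∀ (x : E.Space) (v : W),
      ‖f (ι ℂ x • v)‖ ≤ MatNorm.mnorm (Matrix.of fun (_ _ : Fin 1) => x) * ‖f v‖ := fun x v => by
    have := hB.contr 1 1 (Matrix.of fun _ _ => x) fun _ => v
    simp only [Finset.univ_unique, Finset.sum_singleton, hre, Matrix.of_apply] at this
    rw [← mul_pow] at this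
    exact le_of_sq_le_sq this (mul_nonneg (mnorm_space_nonneg _) (norm_nonneg _))
  -- By the case k = m = 1 of contractivity (`hbd`), the action of `x` is bounded for the seminorm
  -- of the form, so it descends to the dense range of `f` and extends to `K`.
  let L : E.Space → W →ₗ[ℂ] K := fun x => f ∘ₗ Algebra.lsmul ℂ ℂ W (ι ℂ x)
  let T : E.Space → K →L[ℂ] K := fun x => (L x).extendOfNorm f
  have hT : ∀ x v, T x (f v) = f (ι ℂ x • v) := fun x v =>
    LinearMap.extendOfNorm_eq hf ⟨_, hbd x⟩ v
  have hext : ∀ S S' : K →L[ℂ] K, (∀ v, S (f v) = S' (f v)) → S = S' := fun S S' h =>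
    DFunLike.coe_injective (hf.equalizer S.continuous S'.continuous (funext h))
  let σ : E.Space →ₗ[ℂ] (K →L[ℂ] K) :=
    { toFun := T
      map_add' := fun x y => hext _ _ fun v => by simp [hT, add_smul]
      map_smul' := fun c x => hext _ _ fun v => by simp [hT] }
  refine ⟨K, _, _, inferInstance, σ, f, fun k l x => ?_, hf, hT, hfB⟩
  refine mnorm_operator_le _ (mnorm_space_nonneg x) fun y => ?_
  have hd : DenseRange fun v : Fin l → W => fun q => f (v q) := DenseRange.piMap fun _ => hf
  refine hd.induction_on (p := fun y => ∑ i, ‖∑ j, (x.map σ) i j (y j)‖ ^ 2 ≤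
    MatNorm.mnorm x ^ 2 * ∑ j, ‖y j‖ ^ 2) y (isClosed_le (by fun_prop) (by fun_prop)) fun v => ?_
  have := hB.contr k l x v
  simp only [hre, map_sum] at this
  simpa only [Matrix.map_apply, show ∀ x v, σ x (f v) = f (ι ℂ x • v) from hT] using this

/-- Compression of a representation to the orthogonal complement of an invariant subspace that
contains all commutators. -/
theorem exists_commuting_compression {K : Type u} [NormedAddCommGroup K] [InnerProductSpace ℂ K]
    [CompleteSpace K] {σ : E.Space →ₗ[ℂ] (K →L[ℂ] K)} (hσ : IsCompletelyContractive σ)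
    {f : W →ₗ[ℂ] K} (hf : DenseRange f) (h : Intertwines σ f) (V : Submodule ℂ W)
    (hV : ∀ x : E.Space, ∀ v ∈ V, ι ℂ x • v ∈ V)
    (hcomm : ∀ (x y : E.Space) (v : W), ι ℂ x • ι ℂ y • v - ι ℂ y • ι ℂ x • v ∈ V) :
    ∃ (K' : Type u) (_ : NormedAddCommGroup K') (_ : InnerProductSpace ℂ K')
      (_ : CompleteSpace K') (σ' : E.Space →ₗ[ℂ] (K' →L[ℂ] K')) (f' : W →ₗ[ℂ] K'),
      IsCompletelyContractive σ' ∧ (∀ x y, σ' x * σ' y = σ' y * σ' x) ∧ Intertwines σ' f' ∧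
      (∀ v, ‖f' v‖ ≤ ‖f v‖) ∧
      ∀ v (ε : ℝ), 0 < ε → ∃ w ∈ V, ‖f (v + w)‖ ^ 2 < ‖f' v‖ ^ 2 + ε := by
  let N : Submodule ℂ K := (V.map f).topologicalClosure
  have : CompleteSpace N := (V.map f).isClosed_topologicalClosure.completeSpace_coe
  have hNinv : ∀ x, ∀ a ∈ N, σ x a ∈ N := by
    intro x a ha
    refine map_mem_closure (σ x).continuous ha ?_
    rintro _ ⟨v, hv, rfl⟩
    rw [h]
    exact ⟨_, hV x v hv, rfl⟩
  have hNcomm : ∀ x y a, σ x (σ y a) - σ y (σ x a) ∈ N := by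
    intro x y a
    refine hf.induction_on (p := fun a => σ x (σ y a) - σ y (σ x a) ∈ N) a ?_ fun v => ?_
    · exact (V.map f).isClosed_topologicalClosure.preimage
        (f := fun a => σ x (σ y a) - σ y (σ x a)) (by fun_prop)
    · rw [h, h, h, h, ← map_sub]
      exact Submodule.le_topologicalClosure _ ⟨_, hcomm x y v, rfl⟩
  let P : K →L[ℂ] Nᗮ := Nᗮ.orthogonalProjectionOnto
  have hP0 : ∀ a ∈ N, P a = 0 := fun a ha =>
    Nᗮ.orthogonalProjectionOnto_apply_of_mem_orthogonal (N.le_orthogonal_orthogonal ha)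
  have hPsub : ∀ a, a - (P a : K) ∈ N := fun a => by
    rw [show P a = _ from N.orthogonalProjectionOnto_orthogonal a, sub_sub_cancel]
    exact N.starProjection_apply_mem a
  -- Since `N` is invariant, P σ(x) P = P σ(x). Compression to the complement therefore respects
  -- products and the intertwining relation.
  have hPσ : ∀ x a, P (σ x (P a : K)) = P (σ x a) := fun x a => by
    have := hP0 _ (hNinv x _ (hPsub a))
    rw [map_sub, map_sub, sub_eq_zero] at this
    exact this.symm
  let σ' : E.Space →ₗ[ℂ] (Nᗮ →L[ℂ] Nᗮ) :=
    { toFun := fun x => P ∘L σ x ∘L Nᗮ.subtypeL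
      map_add' := fun x y => by ext; simp
      map_smul' := fun c x => by ext; simp }
  have hσ' : ∀ x a, σ' x a = P (σ x a) := fun x a => rfl
  refine ⟨Nᗮ, inferInstance, inferInstance, inferInstance, σ', P.toLinearMap ∘ₗ f,
    fun k l x => ?_, fun x y => ?_, fun x v => ?_, fun v => ?_, fun v ε hε => ?_⟩
  · refine le_trans ?_ (hσ k l x)
    exact mnorm_operator_le_of_contraction (x.map σ) (x.map σ') P.toLinearMap Nᗮ.subtype
      (fun a => Nᗮ.norm_orthogonalProjectionOnto_apply_le a) (fun a => le_rfl) fun i j a => rfl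
  · ext1 a
    have := hP0 _ (hNcomm x y a)
    rw [map_sub, sub_eq_zero] at this
    simpa [hσ', hPσ] using this
  · change σ' x (P (f v)) = P (f _)
    rw [hσ', hPσ, h]
  · exact Nᗮ.norm_orthogonalProjectionOnto_apply_le _
  · change ∃ w ∈ V, ‖f (v + w)‖ ^ 2 < ‖P (f v)‖ ^ 2 + ε
    -- The projection is the point of `f v + N` of least norm, and `N` is the closure of `f V`, so
    -- vectors `f (v + w)` with `w ∈ V` approximate it.
    have hmem : (P (f v) : K) - f v ∈ N := by
      rw [← neg_sub]; exact N.neg_mem (hPsub _)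
    have hop : IsOpen {a : K | ‖f v + a‖ ^ 2 < ‖P (f v)‖ ^ 2 + ε} :=
      isOpen_lt (by fun_prop) continuous_const
    obtain ⟨_, h1, w, hw, rfl⟩ := mem_closure_iff.1 hmem _ hop (by simp [hε])
    exact ⟨w, hw, by simpa using h1⟩

end Forms

/-! ### The completion defined by a class of representations -/

namespace RepClass

variable {P : Type v} [Ring P] [Algebra ℂ P] (F : RepClass.{u} P)
  {K : Type u} [NormedAddCommGroup K] [InnerProductSpace ℂ K] [CompleteSpace K]

theorem norm_toCompl (p : P) : ‖F.toCompl p‖ = ‖F.toAlg p‖ := Completion.norm_coe _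

theorem denseRange_toCompl : DenseRange F.toCompl :=
  Completion.denseRange_coe.comp F.toAlg.surjective.denseRange (Completion.continuous_coe _)

/-- The canonical map into the completion, as an algebra homomorphism. -/
noncomputable def toComplHom : P →ₐ[ℂ] F.Compl where
  toFun := F.toCompl
  map_one' := rfl
  map_mul' p q := Completion.coe_mul (F.toAlg p) (F.toAlg q)
  map_zero' := rfl
  map_add' p q := Completion.coe_add (F.toAlg p) (F.toAlg q)
  commutes' _ := rfl

/-- Homomorphisms on `P` that are contractive for the seminorm of the class extend to the
completion. -/
theorem exists_extension {B : Type*} [NormedRing B] [CompleteSpace B] [Algebra ℂ B]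
    (f : P →ₐ[ℂ] B) (hf : ∀ p, ‖f p‖ ≤ ‖F.toCompl p‖) :
    ∃ g : F.Compl →ₐ[ℂ] B, Continuous g ∧ ∀ p, g (F.toCompl p) = f p := by
  have hc : Continuous (f.comp F.toAlg.symm.toAlgHom) :=
    AddMonoidHomClass.continuous_of_bound _ 1 fun p => by
      rw [one_mul]
      exact (hf _).trans_eq (F.norm_toCompl _)
  have hcoe : ∀ p, Completion.extensionHom (f.comp F.toAlg.symm.toAlgHom).toRingHom hc
      (F.toCompl p) = f p := fun p =>
    Completion.extensionHom_coe (f.comp F.toAlg.symm.toAlgHom).toRingHom hc (F.toAlg p)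
  refine ⟨⟨Completion.extensionHom (f.comp F.toAlg.symm.toAlgHom).toRingHom hc, fun r => ?_⟩,
    Completion.continuous_extension, hcoe⟩
  exact (hcoe (algebraMap ℂ P r)).trans (f.commutes r)

variable {F} in
theorem norm_le_norm_toCompl {π : P →ₐ[ℂ] (K →L[ℂ] K)} (hπ : F.Mem π) (p : P) :
    ‖π p‖ ≤ ‖F.toCompl p‖ :=
  (F.norm_rep_le hπ (F.toAlg p)).trans_eq (F.norm_toCompl p).symm

theorem continuous_extend (π : P →ₐ[ℂ] (K →L[ℂ] K)) : Continuous (F.extend π) :=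
  Completion.continuous_extension

variable {F} in
-- `extend` is only a function by definition; it agrees on a dense set with the multiplicative
-- extension, and both are continuous.
theorem exists_extendHom {π : P →ₐ[ℂ] (K →L[ℂ] K)} (hπ : F.Mem π) :
    ∃ g : F.Compl →ₐ[ℂ] (K →L[ℂ] K), ⇑g = F.extend π := by
  obtain ⟨g, hg, hgp⟩ := F.exists_extension π (norm_le_norm_toCompl hπ)
  exact ⟨g, F.denseRange_toCompl.equalizer hg (F.continuous_extend π)
    (funext fun p => (hgp p).trans (F.extend_toCompl hπ p).symm)⟩

variable {F} in
theorem norm_extend_le {π : P →ₐ[ℂ] (K →L[ℂ] K)} (hπ : F.Mem π) (a : F.Compl) :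
    ‖F.extend π a‖ ≤ ‖a‖ := by
  refine F.denseRange_toCompl.induction_on (p := fun a => ‖F.extend π a‖ ≤ ‖a‖) a
    (isClosed_le (F.continuous_extend π).norm continuous_norm) fun p => ?_
  rw [F.extend_toCompl hπ]
  exact norm_le_norm_toCompl hπ p

variable {F}

theorem mnorm_extend_le {π : P →ₐ[ℂ] (K →L[ℂ] K)} (hπ : F.Mem π) {k l : ℕ}
    (M : Matrix (Fin k) (Fin l) F.Compl) :
    MatNorm.mnorm (M.map (F.extend π)) ≤ MatNorm.mnorm M := by
  refine le_csSup ⟨∑ i, ∑ j, ‖M i j‖, ?_⟩ ⟨K, _, _, _, π, hπ, rfl⟩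
  rintro r ⟨K, _, _, _, π, hπ, rfl⟩
  refine (mnorm_operator_le_sum_norm _).trans ?_
  gcongr
  exact norm_extend_le hπ _

theorem mnorm_le {k l : ℕ} (M : Matrix (Fin k) (Fin l) F.Compl) {C : ℝ} (hC : 0 ≤ C)
    (h : ∀ (K : Type u) [NormedAddCommGroup K] [InnerProductSpace ℂ K] [CompleteSpace K]
      (π : P →ₐ[ℂ] (K →L[ℂ] K)), F.Mem π → MatNorm.mnorm (M.map (F.extend π)) ≤ C) :
    MatNorm.mnorm M ≤ C := by
  refine Real.sSup_le ?_ hC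
  rintro r ⟨K, _, _, _, π, hπ, rfl⟩
  exact h K π hπ

theorem mnorm_nonneg {k l : ℕ} (M : Matrix (Fin k) (Fin l) F.Compl) : 0 ≤ MatNorm.mnorm M := by
  refine Real.sSup_nonneg ?_
  rintro r ⟨K, _, _, _, π, hπ, rfl⟩
  exact mnorm_operator_nonneg _

theorem mnorm_le_sum_norm {k l : ℕ} (M : Matrix (Fin k) (Fin l) F.Compl) :
    MatNorm.mnorm M ≤ ∑ i, ∑ j, ‖M i j‖ := by
  refine mnorm_le M (by positivity) fun K _ _ _ π hπ => (mnorm_operator_le_sum_norm _).trans ?_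
  gcongr
  exact norm_extend_le hπ _

theorem mnorm_add_le {k l : ℕ} (M N : Matrix (Fin k) (Fin l) F.Compl) :
    MatNorm.mnorm (M + N) ≤ MatNorm.mnorm M + MatNorm.mnorm N := by
  refine mnorm_le _ (add_nonneg (mnorm_nonneg M) (mnorm_nonneg N)) fun K _ _ _ π hπ => ?_
  obtain ⟨g, hg⟩ := exists_extendHom hπ
  have : (M + N).map (F.extend π) = M.map (F.extend π) + N.map (F.extend π) := by
    ext1 i j; simp [← hg]
  rw [this]
  exact (mnorm_operator_add_le _ _).trans
    (add_le_add (mnorm_extend_le hπ M) (mnorm_extend_le hπ N))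

/-- On the image of `P` both sides come from the same supremum over the class. The 1 × 1 matrix norm
is Lipschitz, so the inequality passes to the completion. -/
theorem norm_le_mnorm (a : F.Compl) :
    ‖a‖ ≤ MatNorm.mnorm (Matrix.of fun (_ _ : Fin 1) => a) := by
  have hcont : Continuous fun a : F.Compl => MatNorm.mnorm (Matrix.of fun (_ _ : Fin 1) => a) := by
    refine (LipschitzWith.of_le_add fun a b => ?_).continuous
    have h : (Matrix.of fun (_ _ : Fin 1) => a) =
      (Matrix.of fun (_ _ : Fin 1) => b) + (Matrix.of fun (_ _ : Fin 1) => a - b) := by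
      ext; simp
    rw [h, dist_eq_norm]
    refine (mnorm_add_le _ _).trans (add_le_add_right ((mnorm_le_sum_norm _).trans_eq ?_) _)
    simp only [Finset.univ_unique, Finset.sum_singleton, Matrix.of_apply]
    rfl
  refine F.denseRange_toCompl.induction_on
    (p := fun a => ‖a‖ ≤ MatNorm.mnorm (Matrix.of fun (_ _ : Fin 1) => a)) a
    (isClosed_le continuous_norm hcont) fun p => ?_
  rw [norm_toCompl]
  refine F.norm_alg_le _ (mnorm_nonneg _) fun K _ _ _ π hπ => ?_
  refine le_trans ?_ (mnorm_extend_le hπ _)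
  refine (norm_le_mnorm_of _).trans_eq ?_
  congr 1
  ext1 i j
  exact (F.extend_toCompl hπ p).symm

theorem map_extend_toCompl {π : P →ₐ[ℂ] (K →L[ℂ] K)} (hπ : F.Mem π) {k l : ℕ}
    (M : Matrix (Fin k) (Fin l) P) : (M.map F.toCompl).map (F.extend π) = M.map π := by
  ext1 i j
  exact F.extend_toCompl hπ _

end RepClass

/-! ### Distance to the commutator ideal -/

section Distance

open TensorAlgebra (ι)

variable {n : ℕ} {E : OperatorSpace.{u} n}

variable (E) in
/-- The linear map `x ↦ ∑ x_j z_j`. -/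
noncomputable def linearPoly : E.Space →ₗ[ℂ] MvPolynomial (Fin n) ℂ :=
  Fintype.linearCombination ℂ fun j => (MvPolynomial.X j : MvPolynomial (Fin n) ℂ)

variable (E) in
/-- The canonical homomorphism from the tensor algebra to the polynomials. -/
noncomputable def toPoly : TensorAlgebra ℂ E.Space →ₐ[ℂ] MvPolynomial (Fin n) ℂ :=
  TensorAlgebra.lift ℂ (linearPoly E)

variable (E) in
/-- Rows of length `l` over `T(E)`. -/
abbrev Rows (l : ℕ) : Type u := ULift.{u} (Fin l) → TensorAlgebra ℂ E.Space

/-- The `i`-th row of a matrix over `T(E)`. -/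
def rowOf {k l : ℕ} (V : Matrix (Fin k) (Fin l) (TensorAlgebra ℂ E.Space)) (i : Fin k) :
    Rows E l := fun j => V i j.down

variable (E) in
/-- The standard basis of the module of rows. -/
def stdRow {l : ℕ} (j : Fin l) : Rows E l := Pi.single ⟨j⟩ 1

theorem rows_eq_sum {l : ℕ} (v : Rows E l) : v = ∑ j : Fin l, v ⟨j⟩ • stdRow E j := by
  ext i
  rw [Finset.sum_apply, Finset.sum_eq_single i.down]
  · simp [stdRow]
  · intro j _ hj
    have : i ≠ ⟨j⟩ := fun h => hj (h ▸ rfl)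
    simp [stdRow, this]
  · simp

theorem Intertwines.apply_eq_sum {K : Type u} [NormedAddCommGroup K] [InnerProductSpace ℂ K]
    {l : ℕ} {σ : E.Space →ₗ[ℂ] (K →L[ℂ] K)} {f : Rows E l →ₗ[ℂ] K} (h : Intertwines σ f)
    (v : Rows E l) :
    f v = ∑ j : Fin l, TensorAlgebra.lift ℂ σ (v ⟨j⟩) (f (stdRow E j)) := by
  conv_lhs => rw [rows_eq_sum v]
  simp only [map_sum, h.lift_apply]

/-- Every family of vectors is the image of the standard basis under an intertwiner. -/
theorem exists_intertwines {K : Type u} [NormedAddCommGroup K] [InnerProductSpace ℂ K]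
    {l : ℕ} (σ : E.Space →ₗ[ℂ] (K →L[ℂ] K)) (x : Fin l → K) :
    ∃ f : Rows E l →ₗ[ℂ] K, Intertwines σ f ∧
      ∀ v, f v = ∑ j : Fin l, TensorAlgebra.lift ℂ σ (v ⟨j⟩) (x j) := by
  refine ⟨∑ j : Fin l, (LinearMap.applyₗ (x j) ∘ₗ ContinuousLinearMap.coeLM ℂ) ∘ₗ
    (TensorAlgebra.lift ℂ σ).toLinearMap ∘ₗ LinearMap.proj ⟨j⟩, fun y v => ?_, fun v => ?_⟩
  · simp
  · simp

variable (E) in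
/-- The contractive forms on the rows of length `l`, normalized by `∑ ‖e_j‖² ≤ 1`. -/
def contractiveForms (l : ℕ) : Set (Rows E l → Rows E l → ℂ) :=
  {B | IsContractiveForm E B ∧ ∑ j, (B (stdRow E j) (stdRow E j)).re ≤ 1}

theorem norm_lift_le {K : Type u} [NormedAddCommGroup K] [InnerProductSpace ℂ K]
    [CompleteSpace K] {σ : E.Space →ₗ[ℂ] (K →L[ℂ] K)} (hσ : IsCompletelyContractive σ)
    (p : TensorAlgebra ℂ E.Space) :
    ‖TensorAlgebra.lift ℂ σ p‖ ≤ ‖E.tensorReps.toCompl p‖ :=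
  RepClass.norm_le_norm_toCompl (F := E.tensorReps) ⟨σ, hσ, rfl⟩ p

/-- The normalization bounds each GNS vector of a standard row by 1, which gives a pointwise bound
independent of `B`. This is what Tychonoff's theorem needs. -/
theorem norm_le_of_mem_contractiveForms {l : ℕ} {B : Rows E l → Rows E l → ℂ}
    (hB : B ∈ contractiveForms E l) (v w : Rows E l) :
    ‖B v w‖ ≤ (∑ j : Fin l, ‖E.tensorReps.toCompl (v ⟨j⟩)‖) *
      ∑ j : Fin l, ‖E.tensorReps.toCompl (w ⟨j⟩)‖ := by
  obtain ⟨K, _, _, _, σ, f, hσ, -, hf, hfB⟩ := hB.1.exists_rep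
  have he : ∀ j, ‖f (stdRow E j)‖ ≤ 1 := fun j => by
    have h := hB.2
    simp only [← hfB] at h
    have h1 : ∀ j, (inner ℂ (f (stdRow E j)) (f (stdRow E j))).re = ‖f (stdRow E j)‖ ^ 2 :=
      fun j => inner_self_eq_norm_sq (𝕜 := ℂ) _
    simp only [h1] at h
    have h2 := (Finset.single_le_sum (f := fun j => ‖f (stdRow E j)‖ ^ 2)
      (fun i _ => sq_nonneg _) (Finset.mem_univ j)).trans h
    exact le_of_sq_le_sq (by simpa using h2) zero_le_one
  have hv : ∀ v, ‖f v‖ ≤ ∑ j : Fin l, ‖E.tensorReps.toCompl (v ⟨j⟩)‖ := fun v => by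
    rw [hf.apply_eq_sum v]
    refine (norm_sum_le _ _).trans (Finset.sum_le_sum fun j _ => ?_)
    refine (ContinuousLinearMap.le_opNorm _ _).trans ?_
    exact (mul_le_of_le_one_right (norm_nonneg _) (he j)).trans (norm_lift_le hσ _)
  rw [← hfB]
  exact (norm_inner_le_norm _ _).trans (mul_le_mul (hv v) (hv w) (norm_nonneg _) (by positivity))

/-- In the topology of pointwise convergence the forms lie in a product of closed discs, and each
defining condition is closed since it involves finitely many values of `B`. -/
theorem isCompact_contractiveForms (l : ℕ) : IsCompact (contractiveForms E l) := by
  refine IsCompact.of_isClosed_subset (isCompact_univ_pi fun v => isCompact_univ_pi fun w =>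
    isCompact_closedBall (0 : ℂ) ((∑ j : Fin l, ‖E.tensorReps.toCompl (v ⟨j⟩)‖) *
      ∑ j : Fin l, ‖E.tensorReps.toCompl (w ⟨j⟩)‖)) ?_ fun B hB v _ w _ => by
        simpa using norm_le_of_mem_contractiveForms hB v w
  have hcont : ∀ v w, Continuous fun B : Rows E l → Rows E l → ℂ => B v w := fun v w => by fun_prop
  refine IsClosed.and ?_ (isClosed_le (by fun_prop) continuous_const)
  have : {B : Rows E l → Rows E l → ℂ | IsContractiveForm E B} =
      {B | (∀ v w, (starRingEnd ℂ) (B w v) = B v w) ∧ (∀ v, 0 ≤ (B v v).re) ∧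
        (∀ v v' w, B (v + v') w = B v w + B v' w) ∧
        (∀ (v w) (r : ℂ), B (r • v) w = (starRingEnd ℂ) r * B v w) ∧
        (∀ (k m : ℕ) (x : Matrix (Fin k) (Fin m) E.Space) (v : Fin m → Rows E l),
          ∑ p, (B (∑ q, ι ℂ (x p q) • v q) (∑ q, ι ℂ (x p q) • v q)).re ≤
            MatNorm.mnorm x ^ 2 * ∑ q, (B (v q) (v q)).re)} :=
    Set.ext fun B => ⟨fun h => ⟨h.1, h.2, h.3, h.4, h.5⟩, fun h =>
      ⟨h.1, h.2.1, h.2.2.1, h.2.2.2.1, h.2.2.2.2⟩⟩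
  rw [this]
  simp only [Set.ofPred_and, Set.ofPred_forall]
  refine IsClosed.inter ?_ (IsClosed.inter ?_ (IsClosed.inter ?_ (IsClosed.inter ?_ ?_)))
  · exact isClosed_iInter fun v => isClosed_iInter fun w =>
      isClosed_eq (Complex.continuous_conj.comp (hcont _ _)) (hcont _ _)
  · exact isClosed_iInter fun v => isClosed_le continuous_const (by fun_prop)
  · exact isClosed_iInter fun v => isClosed_iInter fun v' => isClosed_iInter fun w =>
      isClosed_eq (hcont _ _) (by fun_prop)
  · exact isClosed_iInter fun v => isClosed_iInter fun w => isClosed_iInter fun r =>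
      isClosed_eq (hcont _ _) (by fun_prop)
  · exact isClosed_iInter fun k => isClosed_iInter fun m => isClosed_iInter fun x =>
      isClosed_iInter fun v => isClosed_le (by fun_prop) (by fun_prop)

theorem convex_contractiveForms (l : ℕ) : Convex ℝ (contractiveForms E l) := by
  intro B hB B' hB' a b ha hb hab
  have hre : ∀ v w, ((a • B + b • B') v w).re = a * (B v w).re + b * (B' v w).re := by
    intro v w; simp
  have hval : ∀ v w, (a • B + b • B') v w = a * B v w + b * B' v w := by
    intro v w; simp
  refine ⟨⟨fun v w => ?_, fun v => ?_, fun v v' w => ?_, fun v w r => ?_, fun k m x v => ?_⟩, ?_⟩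
  · simp [hval, hB.1.conj_symm, hB'.1.conj_symm]
  · rw [hre]
    exact add_nonneg (mul_nonneg ha (hB.1.re_nonneg v)) (mul_nonneg hb (hB'.1.re_nonneg v))
  · rw [hval, hval, hval, hB.1.add_left, hB'.1.add_left]; ring
  · rw [hval, hval, hB.1.smul_left, hB'.1.smul_left]; ring
  · simp only [hre, Finset.sum_add_distrib, ← Finset.mul_sum]
    linarith [mul_le_mul_of_nonneg_left (hB.1.contr k m x v) ha,
      mul_le_mul_of_nonneg_left (hB'.1.contr k m x v) hb]
  · simp only [hre, Finset.sum_add_distrib, ← Finset.mul_sum]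
    linarith [mul_le_mul_of_nonneg_left hB.2 ha, mul_le_mul_of_nonneg_left hB'.2 hb]

/-- Contractive forms are convex functions on the diagonal. -/
theorem IsContractiveForm.re_sum_le {l : ℕ} {B : Rows E l → Rows E l → ℂ}
    (hB : IsContractiveForm E B) {N : Type*} (t : Finset N) (a : N → ℝ) (ha : ∀ i ∈ t, 0 ≤ a i)
    (hsum : ∑ i ∈ t, a i = 1) (v : N → Rows E l) :
    (B (∑ i ∈ t, (a i : ℂ) • v i) (∑ i ∈ t, (a i : ℂ) • v i)).re ≤
      ∑ i ∈ t, a i * (B (v i) (v i)).re := by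
  obtain ⟨K, _, _, _, σ, f, -, -, -, hfB⟩ := hB.exists_rep
  have h1 : ∀ v, (B v v).re = ‖f v‖ ^ 2 := fun v => by
    rw [← hfB]; exact inner_self_eq_norm_sq (𝕜 := ℂ) _
  simp only [h1]
  refine le_trans (pow_le_pow_left₀ (norm_nonneg _) ?_ 2)
    (Real.pow_arith_mean_le_arith_mean_pow t a (fun i => ‖f (v i)‖) ha hsum
      (fun i _ => norm_nonneg _) 2)
  rw [map_sum]
  refine (norm_sum_le _ _).trans (Finset.sum_le_sum fun i hi => ?_)
  rw [map_smul, norm_smul, Complex.norm_of_nonneg (ha i hi)]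

/-- The norm of a matrix over `T(E)` is determined by the contractive forms. -/
theorem mnorm_toCompl_le_of_forms {k l : ℕ}
    (V : Matrix (Fin k) (Fin l) (TensorAlgebra ℂ E.Space)) {c : ℝ} (hc : 0 ≤ c)
    (h : ∀ B ∈ contractiveForms E l, ∑ i, (B (rowOf V i) (rowOf V i)).re ≤ c ^ 2) :
    MatNorm.mnorm (V.map E.tensorReps.toCompl) ≤ c := by
  refine RepClass.mnorm_le _ hc fun K _ _ _ π hπ => ?_
  rw [RepClass.map_extend_toCompl hπ]
  obtain ⟨σ, hσ, rfl⟩ := hπ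
  have key : ∀ x : Fin l → K, ∑ j, ‖x j‖ ^ 2 ≤ 1 →
      ∑ i, ‖∑ j, TensorAlgebra.lift ℂ σ (V i j) (x j)‖ ^ 2 ≤ c ^ 2 := by
    intro x hx
    obtain ⟨f, hf, hfx⟩ := exists_intertwines σ x
    have hre : ∀ y : K, (inner ℂ y y).re = ‖y‖ ^ 2 := fun y => inner_self_eq_norm_sq (𝕜 := ℂ) y
    have hstd : ∀ j, f (stdRow E j) = x j := by
      intro j
      rw [hfx, Finset.sum_eq_single j]
      · simp [stdRow]
      · intro i _ hi
        have : (⟨i⟩ : ULift (Fin l)) ≠ ⟨j⟩ := fun h => hi (ULift.up_injective h)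
        rw [stdRow, Pi.single_eq_of_ne this, map_zero, zero_apply]
      · simp
    have := h (fun v w => inner ℂ (f v) (f w))
      ⟨isContractiveForm_of_intertwines hσ hf, by simpa only [hre, hstd] using hx⟩
    simpa only [hre, hfx, rowOf] using this
  refine mnorm_operator_le _ hc fun x => ?_
  set s := ∑ j, ‖x j‖ ^ 2 with hs
  rcases (show 0 ≤ s by positivity).eq_or_lt with h0 | h0
  · have hx : ∀ j, x j = 0 := fun j => by
      simpa using (Finset.sum_eq_zero_iff_of_nonneg fun i _ => sq_nonneg ‖x i‖).1
        (hs ▸ h0.symm) j (Finset.mem_univ j)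
    simp [hx, ← h0]
  -- Rescale `x` to a unit vector, so that its form satisfies the normalization.
  · have hr : ‖((√s)⁻¹ : ℂ)‖ ^ 2 = s⁻¹ := by
      rw [norm_inv, Complex.norm_of_nonneg (Real.sqrt_nonneg _), inv_pow, Real.sq_sqrt h0.le]
    have := key (fun j => ((√s)⁻¹ : ℂ) • x j) (by
      simp only [norm_smul, mul_pow, hr, ← Finset.mul_sum, ← hs]
      rw [inv_mul_cancel₀ h0.ne'])
    simp only [map_smul, ← Finset.smul_sum, norm_smul, mul_pow, hr, ← Finset.mul_sum] at this
    rw [inv_mul_le_iff₀ h0, mul_comm] at this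
    exact this

/-- If `V` has distance more than `c` from the matrices over the kernel of `T(E) → ℂ[z]`, then
some completely contractive map with commutative range gives `V` a norm of at least `c`. -/
theorem exists_commuting_mnorm_ge {k l : ℕ}
    (V : Matrix (Fin k) (Fin l) (TensorAlgebra ℂ E.Space)) {c : ℝ} (hc : 0 ≤ c)
    (h : ∀ N : Matrix (Fin k) (Fin l) (TensorAlgebra ℂ E.Space), (∀ i j, toPoly E (N i j) = 0) →
      c < MatNorm.mnorm ((V + N).map E.tensorReps.toCompl)) :
    ∃ (K : Type u) (_ : NormedAddCommGroup K) (_ : InnerProductSpace ℂ K) (_ : CompleteSpace K)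
      (σ : E.Space →ₗ[ℂ] (K →L[ℂ] K)), IsCompletelyContractive σ ∧
      (∀ x y, σ x * σ y = σ y * σ x) ∧ c ≤ MatNorm.mnorm (V.map (TensorAlgebra.lift ℂ σ)) := by
  let I := {N : Matrix (Fin k) (Fin l) (TensorAlgebra ℂ E.Space) // ∀ i j, toPoly E (N i j) = 0}
  have : Nonempty I := ⟨⟨0, fun i j => by simp⟩⟩
  let ev : Rows E l → (Rows E l → Rows E l → ℂ) →L[ℝ] ℝ := fun v =>
    Complex.reCLM ∘L ContinuousLinearMap.proj v ∘L
      ContinuousLinearMap.proj (φ := fun _ : Rows E l => Rows E l → ℂ) v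
  let g : I → (Rows E l → Rows E l → ℂ) →L[ℝ] ℝ := fun N => ∑ i, ev (rowOf (V + N.1) i)
  have hg : ∀ N B, g N B = ∑ i, (B (rowOf (V + N.1) i) (rowOf (V + N.1) i)).re := by
    intro N B; simp [g, ev]
  have hconv : ∀ (t : Finset I) (a : I → ℝ), (∀ i ∈ t, 0 ≤ a i) → ∑ i ∈ t, a i = 1 →
      ∃ i, ∀ B ∈ contractiveForms E l, g i B ≤ ∑ j ∈ t, a j * g j B := by
    intro t a ha hsum
    -- The same convex combination of the perturbations works: the weights sum to 1, so V + ∑ a_j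
    -- N_j = ∑ a_j (V + N_j), and B(v, v) is convex in v.
    refine ⟨⟨∑ j ∈ t, (a j : ℂ) • j.1, fun i j => ?_⟩, fun B hB => ?_⟩
    · rw [Matrix.sum_apply, map_sum]
      exact Finset.sum_eq_zero fun m _ => by
        rw [Matrix.smul_apply, map_smul, m.2 i j, smul_zero]
    · simp only [hg, Finset.mul_sum]
      rw [Finset.sum_comm]
      refine Finset.sum_le_sum fun i _ => ?_
      have hrow : rowOf (V + ∑ j ∈ t, (a j : ℂ) • j.1) i =
          ∑ j ∈ t, (a j : ℂ) • rowOf (V + j.1) i := by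
        have h1 : ∑ j ∈ t, (a j : ℂ) = 1 := by exact_mod_cast hsum
        ext m
        simp only [rowOf, Matrix.add_apply, Matrix.sum_apply, Finset.sum_apply, Pi.smul_apply,
          smul_add, Finset.sum_add_distrib, ← Finset.sum_smul, h1, one_smul, Matrix.smul_apply]
      simp only [hrow]
      exact hB.1.re_sum_le t a ha hsum _
  -- Otherwise each form is beaten by some perturbation, and minimax gives one `N` that beats them
  -- all, so that ‖V + N‖ ≤ c.
  obtain ⟨B, hB, hBN⟩ : ∃ B ∈ contractiveForms E l, ∀ N : I, c ^ 2 ≤ g N B := by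
    by_contra! hcon
    obtain ⟨N, hN⟩ := exists_forall_lt_of_forall_exists_lt g (isCompact_contractiveForms l)
      (convex_contractiveForms l) hconv hcon
    refine (h N.1 N.2).not_ge (mnorm_toCompl_le_of_forms _ hc fun B hB => ?_)
    rw [← hg]
    exact (hN B hB).le
  obtain ⟨K₀, _, _, _, σ₀, f₀, hσ₀, hd₀, hf₀, hfB⟩ := hB.1.exists_rep
  have hre : ∀ v, (B v v).re = ‖f₀ v‖ ^ 2 := fun v => by
    rw [← hfB]; exact inner_self_eq_norm_sq (𝕜 := ℂ) _
  let J : Submodule ℂ (Rows E l) := Submodule.pi Set.univ fun _ => (toPoly E).toLinearMap.ker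
  have hJ : ∀ v, v ∈ J ↔ ∀ j, toPoly E (v j) = 0 := fun v => by simp [J, Submodule.mem_pi]
  obtain ⟨K, _, _, _, σ, f, hσ, hcomm, hf, hfle, happ⟩ := exists_commuting_compression hσ₀ hd₀ hf₀
    J (fun x v hv => by rw [hJ] at *; intro j; simp [hv j])
    (fun x y v => by
      rw [hJ]; intro j
      simp only [Pi.sub_apply, Pi.smul_apply, smul_eq_mul, map_sub, map_mul]
      ring)
  refine ⟨K, inferInstance, inferInstance, inferInstance, σ, hσ, hcomm, ?_⟩
  refine le_of_sq_le_sq ?_ (mnorm_operator_nonneg _)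
  have hupper : ∑ i, ‖f (rowOf V i)‖ ^ 2 ≤ MatNorm.mnorm (V.map (TensorAlgebra.lift ℂ σ)) ^ 2 := by
    have h1 := sum_norm_sq_blockOp_le (V.map (TensorAlgebra.lift ℂ σ)) fun j => f (stdRow E j)
    have h2 : ∑ j, ‖f (stdRow E j)‖ ^ 2 ≤ 1 := by
      refine le_trans (Finset.sum_le_sum fun j _ => ?_) hB.2
      rw [hre]
      exact pow_le_pow_left₀ (norm_nonneg _) (hfle _) 2
    simp only [hf.apply_eq_sum (rowOf V _)]
    exact h1.trans (mul_le_of_le_one_right (sq_nonneg _) h2)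
  refine le_trans (le_of_forall_pos_le_add fun ε hε => ?_) hupper
  -- The rows of a perturbation can be chosen independently, so each row of `V` is brought near its
  -- own projection; `k + 1` allows for `k = 0`.
  have hε' : 0 < ε / (k + 1) := by positivity
  choose w hwJ hw using fun i => happ (rowOf V i) _ hε'
  have h1 := hBN ⟨Matrix.of fun i j => w i ⟨j⟩, fun i j => (hJ _).1 (hwJ i) _⟩
  rw [hg] at h1
  refine h1.trans ?_
  calc _ ≤ ∑ i, (‖f (rowOf V i)‖ ^ 2 + ε / (k + 1)) := by
        refine Finset.sum_le_sum fun i _ => ?_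
        rw [hre]
        exact (hw i).le
    _ ≤ _ := by
        rw [Finset.sum_add_distrib, Finset.sum_const, Finset.card_univ, Fintype.card_fin,
          nsmul_eq_mul]
        gcongr
        rw [mul_div_assoc', div_le_iff₀ (by positivity)]
        nlinarith

end Distance

/-! ### The commutator ideal and quotient norms -/

section Quotient

/-- The kernel of `f` is a closed two-sided ideal containing all commutators. -/
theorem map_eq_zero_of_mem_commutatorIdeal {A : Type v} {B : Type w} [Ring A] [TopologicalSpace A]
    [IsTopologicalRing A] [Ring B] [TopologicalSpace B] [T1Space B] (f : A →+* B)
    (hf : Continuous f) (hcomm : ∀ a b, f a * f b = f b * f a) {a : A}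
    (ha : a ∈ commutatorIdeal A) : f a = 0 := by
  have hle : TwoSidedIdeal.span {x : A | ∃ a b : A, x = a * b - b * a} ≤ TwoSidedIdeal.ker f := by
    rw [TwoSidedIdeal.span_le]
    rintro _ ⟨a, b, rfl⟩
    rw [SetLike.mem_coe, TwoSidedIdeal.mem_ker, map_sub, map_mul, map_mul, hcomm, sub_self]
  have ha' : a ∈ closure ((TwoSidedIdeal.span {x : A | ∃ a b : A, x = a * b - b * a}).asIdeal :
    Set A) := ha
  refine closure_minimal (t := f ⁻¹' {0}) (fun x hx => ?_) (isClosed_singleton.preimage hf) ha'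
  exact (TwoSidedIdeal.mem_ker f).1 (hle (TwoSidedIdeal.mem_asIdeal.1 hx))

theorem commutator_mem_commutatorIdeal {A : Type v} [Ring A] [TopologicalSpace A]
    [IsTopologicalRing A] (a b : A) : a * b - b * a ∈ commutatorIdeal A :=
  subset_closure (TwoSidedIdeal.mem_asIdeal.2 (TwoSidedIdeal.subset_span ⟨a, b, rfl⟩))

theorem quotient_commutatorIdeal_mul_comm {A : Type v} [Ring A] [TopologicalSpace A]
    [IsTopologicalRing A] (a b : A ⧸ commutatorIdeal A) : a * b = b * a := by
  obtain ⟨a, rfl⟩ := Ideal.Quotient.mk_surjective a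
  obtain ⟨b, rfl⟩ := Ideal.Quotient.mk_surjective b
  rw [← map_mul, ← map_mul, Ideal.Quotient.mk_eq_mk_iff_sub_mem]
  exact commutator_mem_commutatorIdeal a b

theorem isClosed_commutatorIdeal (A : Type v) [Ring A] [TopologicalSpace A]
    [IsTopologicalRing A] : IsClosed (commutatorIdeal A : Set A) := isClosed_closure

theorem exists_mvPolynomial_hom {n : ℕ} {B : Type*} [Ring B] [Algebra ℂ B]
    (hB : ∀ a b : B, a * b = b * a) (b : Fin n → B) :
    ∃ g : MvPolynomial (Fin n) ℂ →ₐ[ℂ] B, ∀ j, g (MvPolynomial.X j) = b j := by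
  let : CommRing B := { (inferInstance : Ring B) with mul_comm := hB }
  exact ⟨MvPolynomial.aeval b, fun j => MvPolynomial.aeval_X b j⟩

variable {P : Type v} [Ring P] [Algebra ℂ P] {F : RepClass.{u} P} (I : Ideal F.Compl)

theorem mnorm_mk_le [I.IsTwoSided] {k l : ℕ} (N : Matrix (Fin k) (Fin l) F.Compl) :
    MatNorm.mnorm (N.map (Ideal.Quotient.mk I)) ≤ MatNorm.mnorm N := by
  refine csInf_le ⟨0, ?_⟩ ⟨N, rfl, rfl⟩
  rintro _ ⟨N, -, rfl⟩
  exact RepClass.mnorm_nonneg N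

theorem exists_map_mk_eq [I.IsTwoSided] {k l : ℕ} (M : Matrix (Fin k) (Fin l) (F.Compl ⧸ I)) :
    ∃ N : Matrix (Fin k) (Fin l) F.Compl, N.map (Ideal.Quotient.mk I) = M := by
  choose N hN using fun i j => Ideal.Quotient.mk_surjective (M i j)
  exact ⟨Matrix.of N, by ext1 i j; exact hN i j⟩

theorem le_mnorm_quotient [I.IsTwoSided] {k l : ℕ} (M : Matrix (Fin k) (Fin l) (F.Compl ⧸ I))
    {r : ℝ} (h : ∀ N : Matrix (Fin k) (Fin l) F.Compl, N.map (Ideal.Quotient.mk I) = M →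
      r ≤ MatNorm.mnorm N) : r ≤ MatNorm.mnorm M := by
  obtain ⟨N, hN⟩ := exists_map_mk_eq I M
  refine le_csInf ⟨_, N, hN, rfl⟩ ?_
  rintro _ ⟨N, hN, rfl⟩
  exact h N hN

/-- A completely contractive homomorphism on the quotient is continuous on the algebra. -/
theorem continuous_comp_mk [I.IsTwoSided] {K : Type w} [NormedAddCommGroup K]
    [InnerProductSpace ℂ K] (π : (F.Compl ⧸ I) →ₐ[ℂ] (K →L[ℂ] K))
    (hπ : IsCompletelyContractive π) : Continuous fun a => π (Ideal.Quotient.mk I a) := by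
  refine AddMonoidHomClass.continuous_of_bound (π.toRingHom.comp (Ideal.Quotient.mk I)) 1
    fun a => ?_
  rw [one_mul]
  refine (norm_le_mnorm_of _).trans ((hπ 1 1 (Matrix.of fun _ _ => Ideal.Quotient.mk I a)).trans ?_)
  refine (mnorm_mk_le I (Matrix.of fun _ _ => a)).trans ?_
  refine (RepClass.mnorm_le_sum_norm _).trans_eq ?_
  simp only [Finset.univ_unique, Finset.sum_singleton, Matrix.of_apply]
  rfl

/-- Adding `N - N'` to any lift of the class of `N'` gives a lift of the class of `N`. -/
theorem mnorm_mk_le_add [I.IsTwoSided] {k l : ℕ} (N N' : Matrix (Fin k) (Fin l) F.Compl) :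
    MatNorm.mnorm (N.map (Ideal.Quotient.mk I)) ≤
      MatNorm.mnorm (N'.map (Ideal.Quotient.mk I)) + MatNorm.mnorm (N - N') := by
  rw [← sub_le_iff_le_add]
  refine le_mnorm_quotient I _ fun A hA => ?_
  rw [sub_le_iff_le_add]
  refine le_trans (le_of_eq ?_)
    ((mnorm_mk_le I (A + (N - N'))).trans (RepClass.mnorm_add_le _ _))
  congr 1
  ext1 i j
  have hij : Ideal.Quotient.mk I (A i j) = Ideal.Quotient.mk I (N' i j) := congrFun₂ hA i j
  simp only [Matrix.map_apply, Matrix.add_apply, Matrix.sub_apply]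
  rw [RingHom.map_add, RingHom.map_sub, hij, add_sub_cancel]

end Quotient

/-! ### Commuting representations and polynomials -/

section Representations

open OperatorSpace

variable {n : ℕ} {E : OperatorSpace.{u} n}

theorem toPoly_ι (x : E.Space) : toPoly E (TensorAlgebra.ι ℂ x) =
    ∑ j, MvPolynomial.C (x j) * MvPolynomial.X j := by
  have h : ∀ y : Fin n → ℂ, Fintype.linearCombination ℂ
      (fun j => (MvPolynomial.X j : MvPolynomial (Fin n) ℂ)) y =
      ∑ j, MvPolynomial.C (y j) * MvPolynomial.X j := fun y => by
    simp [Fintype.linearCombination_apply, MvPolynomial.smul_eq_C_mul]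
  rw [toPoly, TensorAlgebra.lift_ι_apply]
  exact h x

theorem toPoly_single (j : Fin n) :
    toPoly E (TensorAlgebra.ι ℂ (Pi.single j 1 : Fin n → ℂ)) = MvPolynomial.X j := by
  rw [toPoly]
  refine (TensorAlgebra.lift_ι_apply (R := ℂ) (linearPoly E) _).trans ?_
  change Fintype.linearCombination ℂ _ (Pi.single j 1 : Fin n → ℂ) = _
  simp

theorem toPoly_surjective : Function.Surjective (toPoly E) := by
  intro p
  induction p using MvPolynomial.induction_on with
  | C r => exact ⟨algebraMap ℂ _ r, (toPoly E).commutes r⟩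
  | add a b ha hb =>
    obtain ⟨a, rfl⟩ := ha
    obtain ⟨b, rfl⟩ := hb
    exact ⟨a + b, map_add _ _ _⟩
  | mul_X a j ha =>
    obtain ⟨a, rfl⟩ := ha
    exact ⟨a * _, by rw [map_mul, toPoly_single]⟩

variable {K : Type u} [NormedAddCommGroup K] [InnerProductSpace ℂ K]

theorem polyEval_comp_toPoly (S : Fin n → (K →L[ℂ] K)) (hS : ∀ i j, S i * S j = S j * S i) :
    (polyEval S hS).comp (toPoly E) = TensorAlgebra.lift ℂ (E.tupleMap S) := by
  ext1
  ext1 x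
  change polyEval S hS (toPoly E (TensorAlgebra.ι ℂ x)) =
    TensorAlgebra.lift ℂ (E.tupleMap S) (TensorAlgebra.ι ℂ x)
  rw [toPoly_ι, TensorAlgebra.lift_ι_apply]
  change _ = Fintype.linearCombination ℂ S (x : Fin n → ℂ)
  simp only [map_sum, map_mul, polyEval_X]
  refine Finset.sum_congr rfl fun j _ => ?_
  rw [← MvPolynomial.algebraMap_eq, AlgHom.commutes, Algebra.smul_def]

theorem tupleMap_single (σ : E.Space →ₗ[ℂ] (K →L[ℂ] K)) :
    E.tupleMap (fun j => σ (Pi.single j 1 : Fin n → ℂ)) = σ := by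
  have : ∀ τ : (Fin n → ℂ) →ₗ[ℂ] (K →L[ℂ] K),
      Fintype.linearCombination ℂ (fun j => τ (Pi.single j 1)) = τ := fun τ => by
    ext1 j
    ext1
    simp
  exact this σ

variable [CompleteSpace K]

theorem mem_tensorReps_comp_toPoly {π : MvPolynomial (Fin n) ℂ →ₐ[ℂ] (K →L[ℂ] K)}
    (hπ : E.polyReps.Mem π) : E.tensorReps.Mem (π.comp (toPoly E)) := by
  obtain ⟨S, hS, hcc, rfl⟩ := hπ
  exact ⟨_, hcc, polyEval_comp_toPoly S hS⟩

/-- The tuple consists of the values of σ on the standard basis. Together with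
`mem_tensorReps_comp_toPoly` this matches the class for UC(E) with the commuting part of the class
for OA_u(E). -/
theorem exists_mem_polyReps {σ : E.Space →ₗ[ℂ] (K →L[ℂ] K)} (hσ : IsCompletelyContractive σ)
    (hcomm : ∀ x y, σ x * σ y = σ y * σ x) :
    ∃ π : MvPolynomial (Fin n) ℂ →ₐ[ℂ] (K →L[ℂ] K), E.polyReps.Mem π ∧
      π.comp (toPoly E) = TensorAlgebra.lift ℂ σ := by
  refine ⟨polyEval (fun j => σ (Pi.single j 1 : Fin n → ℂ)) fun i j => hcomm _ _,
    ⟨_, _, ?_, rfl⟩, ?_⟩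
  · rwa [tupleMap_single]
  · rw [polyEval_comp_toPoly, tupleMap_single]

end Representations

/-! ### The homomorphism `OA_u(E) → UC(E)` -/

section Comparison

variable {n : ℕ} (E : OperatorSpace.{u} n)

theorem ιUC_eq (x : E.Space) : E.ιUC x = E.polyReps.toCompl (toPoly E (TensorAlgebra.ι ℂ x)) := by
  rw [toPoly_ι]; rfl

/-- OA_u(E)/𝒞 is commutative, so the map from T(E) into it factors through ℂ[z] and kills ker
`toPoly`. -/
theorem toCompl_mem_commutatorIdeal {p : TensorAlgebra ℂ E.Space} (hp : toPoly E p = 0) :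
    E.tensorReps.toCompl p ∈ commutatorIdeal E.OAu := by
  obtain ⟨g, hg⟩ := exists_mvPolynomial_hom
    (quotient_commutatorIdeal_mul_comm (A := E.OAu)) fun j =>
      Ideal.Quotient.mk (commutatorIdeal E.OAu) (E.ιOA (Pi.single j 1 : Fin n → ℂ))
  have h : g.comp (toPoly E) = (Ideal.Quotient.mkₐ ℂ (commutatorIdeal E.OAu)).comp
      E.tensorReps.toComplHom := by
    refine TensorAlgebra.hom_ext ?_
    have : ∀ τ τ' : (Fin n → ℂ) →ₗ[ℂ] (E.OAu ⧸ commutatorIdeal E.OAu),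
        (∀ j, τ (Pi.single j 1) = τ' (Pi.single j 1)) → τ = τ' := fun τ τ' h => by
      ext1 j; ext1; exact h j
    refine this _ _ fun j => ?_
    change g (toPoly E (TensorAlgebra.ι ℂ (Pi.single j 1 : Fin n → ℂ))) = _
    rw [toPoly_single, hg]
    rfl
  have := AlgHom.congr_fun h p
  rw [AlgHom.comp_apply, hp, map_zero] at this
  exact Ideal.Quotient.eq_zero_iff_mem.1 this.symm

theorem uc_mul_comm (a b : E.UC) : a * b = b * a := by
  refine Completion.induction_on₂ a b (isClosed_eq (by fun_prop) (by fun_prop)) fun p q => ?_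
  rw [← Completion.coe_mul, ← Completion.coe_mul]
  exact congrArg _ (mul_comm (E.polyReps.toAlg.symm p) (E.polyReps.toAlg.symm q))

theorem norm_toCompl_toPoly_le (p : TensorAlgebra ℂ E.Space) :
    ‖E.polyReps.toCompl (toPoly E p)‖ ≤ ‖E.tensorReps.toCompl p‖ := by
  rw [RepClass.norm_toCompl]
  refine E.polyReps.norm_alg_le _ (norm_nonneg _) fun K _ _ _ π hπ => ?_
  exact RepClass.norm_le_norm_toCompl (mem_tensorReps_comp_toPoly hπ) p

theorem exists_hom_OAu_UC : ∃ h : E.OAu →ₐ[ℂ] E.UC, Continuous h ∧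
    ∀ p, h (E.tensorReps.toCompl p) = E.polyReps.toCompl (toPoly E p) :=
  E.tensorReps.exists_extension (B := E.UC) (E.polyReps.toComplHom.comp (toPoly E))
    (norm_toCompl_toPoly_le E)

theorem exists_hom_quotient_UC : ∃ h : (E.OAu ⧸ commutatorIdeal E.OAu) →ₐ[ℂ] E.UC,
    (Continuous fun a => h (Ideal.Quotient.mk _ a)) ∧
    ∀ p, h (Ideal.Quotient.mk _ (E.tensorReps.toCompl p)) = E.polyReps.toCompl (toPoly E p) := by
  obtain ⟨h, hc, hp⟩ := exists_hom_OAu_UC E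
  exact ⟨Ideal.Quotient.liftₐ (commutatorIdeal E.OAu) h fun a ha =>
    map_eq_zero_of_mem_commutatorIdeal h.toRingHom hc (fun a b => uc_mul_comm E _ _) ha, hc, hp⟩

variable {E}

theorem extend_hom_mk {h : (E.OAu ⧸ commutatorIdeal E.OAu) →ₐ[ℂ] E.UC}
    (hc : Continuous fun a => h (Ideal.Quotient.mk _ a))
    (hp : ∀ p, h (Ideal.Quotient.mk _ (E.tensorReps.toCompl p)) =
      E.polyReps.toCompl (toPoly E p))
    {K : Type u} [NormedAddCommGroup K] [InnerProductSpace ℂ K] [CompleteSpace K]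
    {π : MvPolynomial (Fin n) ℂ →ₐ[ℂ] (K →L[ℂ] K)} (hπ : E.polyReps.Mem π) (a : E.OAu) :
    E.polyReps.extend π (h (Ideal.Quotient.mk _ a)) =
      E.tensorReps.extend (π.comp (toPoly E)) a := by
  refine congrFun (E.tensorReps.denseRange_toCompl.equalizer
    ((E.polyReps.continuous_extend π).comp hc) (E.tensorReps.continuous_extend _)
    (funext fun p => ?_)) a
  simp only [Function.comp_apply]
  rw [hp, RepClass.extend_toCompl _ hπ, RepClass.extend_toCompl _ (mem_tensorReps_comp_toPoly hπ)]
  rfl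

theorem mnorm_hom_mk_le {h : (E.OAu ⧸ commutatorIdeal E.OAu) →ₐ[ℂ] E.UC}
    (hc : Continuous fun a => h (Ideal.Quotient.mk _ a))
    (hp : ∀ p, h (Ideal.Quotient.mk _ (E.tensorReps.toCompl p)) =
      E.polyReps.toCompl (toPoly E p)) {k l : ℕ} (N : Matrix (Fin k) (Fin l) E.OAu) :
    MatNorm.mnorm (N.map fun a => h (Ideal.Quotient.mk _ a)) ≤ MatNorm.mnorm N := by
  refine RepClass.mnorm_le _ (RepClass.mnorm_nonneg N) fun K _ _ _ π hπ => ?_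
  refine le_trans (le_of_eq ?_) (RepClass.mnorm_extend_le (mem_tensorReps_comp_toPoly hπ) N)
  congr 1
  ext1 i j
  exact extend_hom_mk hc hp hπ _

/-- The quotient norm of a matrix over the image of `T(E)` is the norm over `UC(E)`. -/
theorem mnorm_mk_toCompl_le {k l : ℕ} (V : Matrix (Fin k) (Fin l) (TensorAlgebra ℂ E.Space)) :
    MatNorm.mnorm ((V.map E.tensorReps.toCompl).map (Ideal.Quotient.mk (commutatorIdeal E.OAu))) ≤
      MatNorm.mnorm (V.map fun p => E.polyReps.toCompl (toPoly E p)) := by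
  refine le_of_forall_lt_imp_le_of_dense fun c hc => ?_
  -- Negative `c` is separated because `exists_commuting_mnorm_ge` compares squares.
  rcases lt_or_ge c 0 with h0 | h0
  · exact h0.le.trans (RepClass.mnorm_nonneg _)
  obtain ⟨K, _, _, _, σ, hσ, hcomm, hle⟩ := exists_commuting_mnorm_ge V h0 fun N hN => by
    refine hc.trans_le (le_trans (le_of_eq ?_) (mnorm_mk_le (commutatorIdeal E.OAu) _))
    congr 1
    ext1 i j
    change Ideal.Quotient.mk _ (E.tensorReps.toComplHom (V i j)) =
      Ideal.Quotient.mk _ (E.tensorReps.toComplHom (V i j + N i j))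
    rw [Ideal.Quotient.mk_eq_mk_iff_sub_mem, ← map_sub, sub_add_cancel_left]
    exact toCompl_mem_commutatorIdeal E (by rw [map_neg, hN i j, neg_zero])
  obtain ⟨π, hπ, hπσ⟩ := exists_mem_polyReps hσ hcomm
  refine hle.trans (le_trans (le_of_eq ?_) (RepClass.mnorm_extend_le hπ _))
  congr 1
  ext1 i j
  exact (AlgHom.congr_fun hπσ _).symm.trans (RepClass.extend_toCompl _ hπ _).symm

/-- One inequality holds for every lift. For the other, a lift is approximated by a matrix over
T(E), where `mnorm_mk_toCompl_le` applies; the approximation costs ε/2 in the quotient and ε/2 in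
UC(E). -/
theorem isCompletelyIsometric_hom {h : (E.OAu ⧸ commutatorIdeal E.OAu) →ₐ[ℂ] E.UC}
    (hc : Continuous fun a => h (Ideal.Quotient.mk _ a))
    (hp : ∀ p, h (Ideal.Quotient.mk _ (E.tensorReps.toCompl p)) =
      E.polyReps.toCompl (toPoly E p)) : IsCompletelyIsometric h := by
  intro k l M
  refine le_antisymm (le_mnorm_quotient _ _ fun N hN => ?_) (le_of_forall_pos_le_add fun ε hε => ?_)
  · rw [← hN]
    exact mnorm_hom_mk_le hc hp N
  obtain ⟨N, rfl⟩ := exists_map_mk_eq _ M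
  obtain ⟨V, hV⟩ : ∃ V : Matrix (Fin k) (Fin l) (TensorAlgebra ℂ E.Space),
      ∑ i, ∑ j, ‖N i j - E.tensorReps.toCompl (V i j)‖ ≤ ε / 2 := by
    have hδ : 0 < ε / 2 / (k * l + 1) := by positivity
    choose V hV using fun i j => E.tensorReps.denseRange_toCompl.exists_dist_lt (N i j) hδ
    refine ⟨Matrix.of V, ?_⟩
    calc _ ≤ ∑ _i : Fin k, ∑ _j : Fin l, ε / 2 / (k * l + 1) := by
          gcongr with i _ j _
          have := (hV i j).le
          rw [dist_eq_norm] at this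
          exact this
      _ ≤ ε / 2 := by
          simp only [Finset.sum_const, Finset.card_univ, Fintype.card_fin, nsmul_eq_mul]
          rw [← mul_assoc, mul_div_assoc', div_le_iff₀ (by positivity)]
          nlinarith
  set V' := V.map E.tensorReps.toCompl with hV'
  have h1 : MatNorm.mnorm (N - V') ≤ ε / 2 := (RepClass.mnorm_le_sum_norm _).trans hV
  have h2 : MatNorm.mnorm (V' - N) ≤ ε / 2 := by
    refine (RepClass.mnorm_le_sum_norm _).trans (le_trans (le_of_eq ?_) hV)
    refine Finset.sum_congr rfl fun i _ => Finset.sum_congr rfl fun j _ => ?_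
    exact norm_sub_rev (E.tensorReps.toCompl (V i j)) (N i j)
  have h3 : MatNorm.mnorm (V.map fun p => E.polyReps.toCompl (toPoly E p)) ≤
      MatNorm.mnorm ((N.map (Ideal.Quotient.mk (commutatorIdeal E.OAu))).map h) + ε / 2 := by
    refine le_trans (le_of_eq ?_) ((RepClass.mnorm_add_le _ _).trans
      (add_le_add_right ((mnorm_hom_mk_le hc hp (V' - N)).trans h2) _))
    congr 1
    ext1 i j
    simp only [Matrix.map_apply, Matrix.add_apply, Matrix.sub_apply, V', ← hp]
    rw [RingHom.map_sub, map_sub, add_sub_cancel]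
  linarith [mnorm_mk_le_add (commutatorIdeal E.OAu) N V', mnorm_mk_toCompl_le V]

end Comparison

/-! ### Bijectivity of the comparison map and uniqueness of homomorphisms -/

section Bijectivity

variable {n : ℕ} {E : OperatorSpace.{u} n}

/-- The isometry bounds h below by the usual quotient norm, which is complete. So h is injective
with closed range, and the range contains the dense image of the polynomials. -/
theorem bijective_hom {h : (E.OAu ⧸ commutatorIdeal E.OAu) →ₐ[ℂ] E.UC}
    (hc : Continuous fun a => h (Ideal.Quotient.mk _ a))
    (hp : ∀ p, h (Ideal.Quotient.mk _ (E.tensorReps.toCompl p)) =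
      E.polyReps.toCompl (toPoly E p)) : Function.Bijective h := by
  -- Closedness of the ideal makes the quotient seminorm a norm.
  have hcl : IsClosed (commutatorIdeal E.OAu : Set E.OAu) := isClosed_commutatorIdeal _
  let : NormedAddCommGroup (E.OAu ⧸ commutatorIdeal E.OAu) :=
    Submodule.Quotient.normedAddCommGroup (commutatorIdeal E.OAu)
  have : CompleteSpace (E.OAu ⧸ commutatorIdeal E.OAu) :=
    Submodule.Quotient.completeSpace (commutatorIdeal E.OAu)
  have hle : ∀ m, ‖m‖ ≤ ‖h m‖ := fun m => by
    have h1 : ‖m‖ ≤ MatNorm.mnorm (Matrix.of fun (_ _ : Fin 1) => m) := by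
      refine le_mnorm_quotient _ _ fun N hN => ?_
      have h2 : Submodule.Quotient.mk (N 0 0) = m := congrFun₂ hN 0 0
      rw [← h2]
      refine (Submodule.Quotient.norm_mk_le _ (N 0 0)).trans ((RepClass.norm_le_mnorm _).trans ?_)
      refine le_of_eq (congrArg _ ?_)
      ext1 i j
      rw [Subsingleton.elim i 0, Subsingleton.elim j 0]
      rfl
    rw [← isCompletelyIsometric_hom hc hp] at h1
    refine h1.trans ((RepClass.mnorm_le_sum_norm _).trans_eq ?_)
    simp only [Finset.univ_unique, Finset.sum_singleton, Matrix.map_apply, Matrix.of_apply]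
  refine ⟨(injective_iff_map_eq_zero h).2 fun m hm => ?_, fun u => ?_⟩
  · exact norm_le_zero_iff.1 ((hle m).trans_eq (by rw [hm]; exact norm_zero (E := E.UC)))
  · have hanti : AntilipschitzWith 1 h := AddMonoidHomClass.antilipschitz_of_bound h fun m => by
      rw [NNReal.coe_one, one_mul]
      exact hle m
    have hcont : Continuous h := continuous_coinduced_dom.2 hc
    have hclosed : IsClosed (Set.range h) :=
      hanti.isClosed_range (uniformContinuous_addMonoidHom_of_continuous hcont)
    have hdense : DenseRange h := E.polyReps.denseRange_toCompl.mono (by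
      rintro _ ⟨q, rfl⟩
      obtain ⟨p, rfl⟩ := toPoly_surjective (E := E) q
      exact ⟨_, hp p⟩)
    have : u ∈ Set.range h := hclosed.closure_eq ▸ hdense u
    exact this

/-- Completely contractive homomorphisms on the quotient are determined by their values on `E`. -/
theorem hom_quotient_ext {K : Type u} [NormedAddCommGroup K] [InnerProductSpace ℂ K]
    [CompleteSpace K] {π π' : (E.OAu ⧸ commutatorIdeal E.OAu) →ₐ[ℂ] (K →L[ℂ] K)}
    (hπ : IsCompletelyContractive π) (hπ' : IsCompletelyContractive π')
    (h : ∀ x : E.Space, π (Ideal.Quotient.mk _ (E.ιOA x)) =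
      π' (Ideal.Quotient.mk _ (E.ιOA x))) : π = π' := by
  have h1 : ((π.comp (Ideal.Quotient.mkₐ ℂ _)).comp E.tensorReps.toComplHom) =
      ((π'.comp (Ideal.Quotient.mkₐ ℂ _)).comp E.tensorReps.toComplHom) :=
    TensorAlgebra.hom_ext (LinearMap.ext h)
  have h2 := E.tensorReps.denseRange_toCompl.equalizer (continuous_comp_mk _ π hπ)
    (continuous_comp_mk _ π' hπ') (funext fun p => AlgHom.congr_fun h1 p)
  refine AlgHom.ext fun m => ?_
  obtain ⟨a, rfl⟩ := Ideal.Quotient.mk_surjective m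
  exact congrFun h2 a

end Bijectivity

/-! ### The completely isometric embedding of E in UC(E) -/

section Embedding

variable {n : ℕ} (E : OperatorSpace.{u} n)

/-- `E` has a completely isometric representation with commutative range, by nilpotent block
matrices. -/
theorem exists_commuting_completelyIsometric :
    ∃ (K : Type u) (_ : NormedAddCommGroup K) (_ : InnerProductSpace ℂ K) (_ : CompleteSpace K)
      (σ : E.Space →ₗ[ℂ] (K →L[ℂ] K)), IsCompletelyIsometric σ ∧
      ∀ x y, σ x * σ y = σ y * σ x := by
  let inj : Fin 2 → E.H →ₗ[ℂ] PiLp 2 (fun _ : Fin 2 => E.H) := fun i =>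
    (WithLp.linearEquiv 2 ℂ (Fin 2 → E.H)).symm.toLinearMap ∘ₗ LinearMap.single ℂ (fun _ => E.H) i
  have hinj : ∀ i y, inj i y = PiLp.single 2 i y := fun i y => rfl
  let pr : Fin 2 → PiLp 2 (fun _ : Fin 2 => E.H) →ₗ[ℂ] E.H := fun i => (PiLp.proj 2 (fun _ : Fin 2 => E.H) i).toLinearMap
  -- Any two such corner matrices have product zero, hence commute.
  let T : E.Space → PiLp 2 (fun _ : Fin 2 => E.H) →L[ℂ] PiLp 2 (fun _ : Fin 2 => E.H) := fun x =>
    blockOp (Matrix.of ![![0, E.φ x], ![0, 0]])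
  have hT0 : ∀ x v, T x v 0 = E.φ x (v 1) := fun x v => by simp [T, blockOp_apply]
  have hT1 : ∀ x v, T x v 1 = 0 := fun x v => by simp [T, blockOp_apply]
  let σ : E.Space →ₗ[ℂ] (PiLp 2 (fun _ : Fin 2 => E.H) →L[ℂ] PiLp 2 (fun _ : Fin 2 => E.H)) :=
    { toFun := T
      map_add' := fun x y => by
        ext v i
        fin_cases i
        · have : E.φ (x + y) = E.φ x + E.φ y := E.φ.map_add x y
          simp [hT0, this]
        · simp [hT1]
      map_smul' := fun c x => by
        ext v i
        fin_cases i
        · have : E.φ (c • x) = c • E.φ x := E.φ.map_smul c x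
          simp [hT0, this]
        · simp [hT1] }
  refine ⟨PiLp 2 (fun _ : Fin 2 => E.H), inferInstance, inferInstance, inferInstance, σ, fun k l M => le_antisymm ?_ ?_,
    fun x y => ?_⟩
  -- Each of φ and σ is obtained from the other by coordinate inclusions and projections, which are
  -- contractions.
  · refine mnorm_operator_le_of_contraction (M.map fun x => E.φ x) (M.map σ) (inj 0) (pr 1)
      (fun y => by simp [hinj]) (fun v => PiLp.norm_apply_le v 1) fun i j v => ?_
    ext m
    fin_cases m
    · exact (hT0 _ _).trans (by simp [hinj, pr])
    · exact (hT1 _ _).trans (by simp [hinj])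
  · refine mnorm_operator_le_of_contraction (M.map σ) (M.map fun x => E.φ x) (pr 0) (inj 1)
      (fun v => PiLp.norm_apply_le v 0) (fun y => by simp [hinj]) fun i j v => ?_
    exact ((hT0 _ _).trans (by simp [hinj])).symm
  · ext v i
    change T x (T y v) i = T y (T x v) i
    fin_cases i
    · simp [hT0, hT1]
    · simp [hT1]

/-- Every representation in the class restricts to a complete contraction on E, and the corner
representation attains the norm. -/
theorem isCompletelyIsometric_ιUC : IsCompletelyIsometric E.ιUC := by
  intro k l M
  have hev : ∀ {K : Type u} [NormedAddCommGroup K] [InnerProductSpace ℂ K] [CompleteSpace K]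
      {π : MvPolynomial (Fin n) ℂ →ₐ[ℂ] (K →L[ℂ] K)} {σ : E.Space →ₗ[ℂ] (K →L[ℂ] K)},
      E.polyReps.Mem π → π.comp (toPoly E) = TensorAlgebra.lift ℂ σ →
      (M.map E.ιUC).map (E.polyReps.extend π) = M.map σ := by
    intro K _ _ _ π σ hπ h
    ext1 i j
    simp only [Matrix.map_apply, ιUC_eq]
    rw [RepClass.extend_toCompl _ hπ, ← AlgHom.comp_apply, h, TensorAlgebra.lift_ι_apply]
  refine le_antisymm (RepClass.mnorm_le _ (mnorm_space_nonneg M) fun K _ _ _ π hπ => ?_) ?_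
  · obtain ⟨σ, hσ, h⟩ := mem_tensorReps_comp_toPoly hπ
    rw [hev hπ h]
    exact hσ k l M
  · obtain ⟨K, _, _, _, σ, hσ, hcomm⟩ := exists_commuting_completelyIsometric E
    obtain ⟨π, hπ, h⟩ := exists_mem_polyReps (fun k l M => (hσ k l M).le) hcomm
    rw [← hσ k l M, ← hev hπ h]
    exact RepClass.mnorm_extend_le hπ _

end Embedding

end OpAlg

theorem mainTheorem6 {n : ℕ} (E : OpAlg.OperatorSpace.{u} n) :
    -- the canonical completely isometric isomorphism `UC(E) ≅ OA_u(E) / 𝒞`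
    (∃ Θ : E.UC ≃ₐ[ℂ] (E.OAu ⧸ OpAlg.commutatorIdeal E.OAu),
      OpAlg.IsCompletelyIsometric Θ ∧
      ∀ x : E.Space, Θ (E.ιUC x) = Ideal.Quotient.mk (OpAlg.commutatorIdeal E.OAu) (E.ιOA x)) ∧
    -- `E` embeds completely isometrically in `OA_u(E) / 𝒞`
    OpAlg.IsCompletelyIsometric
      (fun x : E.Space => Ideal.Quotient.mk (OpAlg.commutatorIdeal E.OAu) (E.ιOA x)) ∧
    -- `OA_u(E) / 𝒞` has the universal property of `UC(E)`
    (∀ (K : Type u) [NormedAddCommGroup K] [InnerProductSpace ℂ K] [CompleteSpace K]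
      (σ : E.Space →ₗ[ℂ] (K →L[ℂ] K)),
      OpAlg.IsCompletelyContractive σ → (∀ x y, σ x * σ y = σ y * σ x) →
      ∃! π : (E.OAu ⧸ OpAlg.commutatorIdeal E.OAu) →ₐ[ℂ] (K →L[ℂ] K),
        OpAlg.IsCompletelyContractive π ∧
        ∀ x : E.Space, π (Ideal.Quotient.mk (OpAlg.commutatorIdeal E.OAu) (E.ιOA x)) = σ x) := by
  obtain ⟨h, hc, hp⟩ := OpAlg.exists_hom_quotient_UC E
  have hiso := OpAlg.isCompletelyIsometric_hom hc hp
  have hι : ∀ x : E.Space, h (Ideal.Quotient.mk _ (E.ιOA x)) = E.ιUC x := fun x =>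
    (hp _).trans (OpAlg.ιUC_eq E x).symm
  let Φ := AlgEquiv.ofBijective h (OpAlg.bijective_hom hc hp)
  refine ⟨⟨Φ.symm, fun k l M => ?_, fun x => ?_⟩, fun k l M => ?_, ?_⟩
  · rw [← hiso]
    congr 1
    ext1 i j
    exact Φ.apply_symm_apply (M i j)
  · rw [← hι x]
    exact Φ.symm_apply_apply _
  · rw [← OpAlg.isCompletelyIsometric_ιUC, ← hiso]
    congr 1
    ext1 i j
    exact hι _
  · intro K _ _ _ σ hσ hcomm
    -- The required homomorphism is h followed by the extension to UC(E) of the polynomial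
    -- representation attached to σ.
    obtain ⟨ρ, hρ, hρσ⟩ := OpAlg.exists_mem_polyReps hσ hcomm
    obtain ⟨g, hg⟩ := OpAlg.RepClass.exists_extendHom hρ
    have hcc : OpAlg.IsCompletelyContractive (g.comp h) := fun k l M => by
      rw [← hiso k l M]
      refine le_trans (le_of_eq ?_) (OpAlg.RepClass.mnorm_extend_le hρ _)
      rw [← hg]
      rfl
    have hval : ∀ x : E.Space, g.comp h (Ideal.Quotient.mk _ (E.ιOA x)) = σ x := fun x => by
      rw [AlgHom.comp_apply, hι, hg, OpAlg.ιUC_eq, OpAlg.RepClass.extend_toCompl _ hρ,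
        ← AlgHom.comp_apply, hρσ, TensorAlgebra.lift_ι_apply]
    exact ⟨g.comp h, ⟨hcc, hval⟩, fun π hπ =>
      OpAlg.hom_quotient_ext hπ.1 hcc fun x => (hπ.2 x).trans (hval x).symm⟩
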